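/- **Setting.** Consider a grid with $n$ buses, one DSO per bus, linearized power flow $v(q)=Rp+Xq+v_0$ with $X$ symmetric, cost coefficients $C_i>0$, reactive power limits $\underline q_i<\overline q_i$ with $\underline q_i\le 0\le\overline q_i$, a tariff $\gamma>0$, voltage limits $\underline v,\overline v\in\mathbb R^n$ and a penalty weight $\rho>0$. Put $\Pi(q_i,v_i,v_i^{\rm ref})=\gamma(v_i-v_i^{\rm ref})q_i$. Given $v_{\rm ref}\in\mathbb R^n$, DSO $i$ minimizes $f_i(v_i^{\rm ref},\xi)=\tfrac12C_i\xi_i^2-\Pi(\xi_i,v_i(\xi),v_i^{\rm ref})$ over $\xi_i\in[\underline q_i,\overline q_i]$. Let $M=\operatorname{diag}(C)-\gamma\big(X+\operatorname{diag}(X_{ii})\big)$, assume $\lambda_{\min}(M)\ge\mu>0$, let $L=\|M\|$ (spectral norm) and let $\eta>0$ satisfy $\eta L^2<2\mu$. Let $F_i(v_{\rm ref},\xi)=C_i\xi_i-\gamma(v_i(\xi)-v_i^{\rm ref})-\gamma\xi_iX_{ii}$ be the pseudo-gradient. *Inner loop.* For fixed $v_{\rm ref}$, iterate $$\tilde\xi^{l+1}=\mathbb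 P_{[\underline q,\overline q]}\big(\tilde\xi^l-\eta F(v_{\rm ref},\tilde\xi^l)\big),\qquad \tilde s^{l+1}=D\,(I-\eta M)\,\tilde s^l-\eta\gamma D ,$$ where $D$ is the diagonal $0/1$ matrix with $D_{ii}=1$ iff the $i$-th coordinate of $\tilde\xi^{l+1}-\eta F(v_{\rm ref},\tilde\xi^{l+1})$ lies in $[\underline q_i,\overline q_i]$. With tolerance $\sigma$ the loop stops at the first $l$ with $\max\{\|\tilde\xi^{l+1}-\tilde\xi^l\|,\|\tilde s^{l+1}-\tilde s^l\|\}\le\sigma$ (Euclidean and spectral norm) and returns $(\tilde\xi^{l+1},\tilde s^{l+1})$. *Relaxed problem.* Minimize $\varphi_e(v_{\rm ref})=\varphi\big(v_{\rm ref},v(q^*(v_{\rm ref})),q^*(v_{\rm ref})\big)$ over $v_{\rm ref}\in\mathbb R^n$, where $q^*(v_{\rm ref})$ is the Nash equilibrium and $\varphi(v_{\rm ref},v,q)=\sum_i\Pi(q_i,v_i,v_i^{\rm ref})+\phi(v)$, $\phi(v)=\rho\sum_i\big(\max\{0,v_i-\overline v_i\}^2+\max\{0,\underline v_i-v_i\}^2\big)$.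 A point is critical if $0$ belongs to the Clarke subdifferential of $\varphi_e$ there (the convex hull of limits of gradients at nearby points of differentiability). *Algorithm.* In round $k=0,1,2,\dots$ run the inner loop for $v_{\rm ref}^k$ from $(\xi^k,s^k)$ with tolerance $\sigma^k$; it returns $(\xi^{k+1},s^{k+1})$. Then $v_{\rm ref}^{k+1}=v_{\rm ref}^k-\epsilon^k\,g^k$, where $g^k=\hat\nabla(v_{\rm ref}^k,\xi,s)$, $$\hat\nabla(v_{\rm ref},\xi,s)=-\gamma\xi+(Xs)^\top\big(\gamma\xi+\nabla\phi(v(\xi))\big)+s^\top\gamma\big(v(\xi)-v_{\rm ref}\big),$$ evaluated, throughout the run, either at $(\xi,s)=(\xi^k,s^k)$ or at $(\xi,s)=(\xi^{k+1},s^{k+1})$. The statement is claimed for both variants. **Theorem.** 1. For every $v_{\rm ref}$ the game has exactly one Nash equilibrium $q^*(v_{\rm ref})$. 2. With $\theta=\sqrt{1-\eta(2\mu-\eta L^2)}<1$, for every $v_{\rm ref}$ and every start, $\|\tilde\xi^l-q^*(v_{\rm ref})\|\le\theta^l\|\tilde\xi^0-q^*(v_{\rm ref})\|$ for all $l$. 3.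 If $q^*$ is differentiable at $v_{\rm ref}$ then, for every start, $\tilde s^l$ converges to the Jacobian $\mathbf Jq^*(v_{\rm ref})$. 4. Let $\epsilon^k>0$, $\epsilon^k\to0$, $\sum_k\epsilon^k=\infty$ and $\sigma^k>0$, $\sigma^k\to0$. For every infinite run of the algorithm (that is, whenever every inner loop stops), from any initial data, every accumulation point of $(v_{\rm ref}^k)$ is a critical point of $\varphi_e$, at least one accumulation point exists, and $\varphi_e(v_{\rm ref}^k)$ converges to the value of $\varphi_e$ at such a point. 5. Such runs exist: for all tolerances $\sigma^k>0$ with $\sigma^k\to0$ and for Lebesgue-almost every initial $v_{\rm ref}^0$, for all $\xi^0,s^0$ there are step sizes $\epsilon^k>0$ with $\epsilon^k\to0$, $\sum_k\epsilon^k=\infty$, for which every inner loop stops. -/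

import Mathlib

open Filter Topology Matrix

/-- `ℝⁿ` with the Euclidean norm. -/
abbrev Vec (n : ℕ) := EuclideanSpace ℝ (Fin n)

/-- The spectral norm of a square matrix. -/
noncomputable def specNorm {n : ℕ} (A : Matrix (Fin n) (Fin n) ℝ) : ℝ :=
  ‖Matrix.toEuclideanCLM (n := Fin n) (𝕜 := ℝ) A‖

/-- The data of the voltage-support game on a grid with `n` buses, one DSO per bus. -/
structure GridGame (n : ℕ) where
  /-- resistance matrix of the linearized power flow -/
  R : Matrix (Fin n) (Fin n) ℝ
  /-- reactance matrix of the linearized power flow -/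
  X : Matrix (Fin n) (Fin n) ℝ
  /-- active power demands -/
  p : Fin n → ℝ
  /-- baseline voltage profile -/
  v₀ : Fin n → ℝ
  /-- cost coefficients of the DSOs -/
  C : Fin n → ℝ
  /-- tariff coefficient -/
  γ : ℝ
  /-- lower reactive power limits -/
  qlo : Fin n → ℝ
  /-- upper reactive power limits -/
  qhi : Fin n → ℝ
  /-- lower voltage limits -/
  vlo : Fin n → ℝ
  /-- upper voltage limits -/
  vhi : Fin n → ℝ
  /-- weight of the penalty on the violation of the voltage limits -/
  ρ : ℝ

namespace GridGame

variable {n : ℕ} (G : GridGame n)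

/-! ### The lower-level game -/

/-- Linearized power flow `v = R p + X q + v₀`. -/
noncomputable def voltage (q : Vec n) : Vec n :=
  WithLp.toLp 2 fun i => (G.R *ᵥ G.p) i + (G.X *ᵥ q.ofLp) i + G.v₀ i

/-- The incentive `Π(qᵢ, vᵢ, vᵢʳᵉᶠ) = γ (vᵢ - vᵢʳᵉᶠ) qᵢ`. -/
noncomputable def incentive (qi vi ri : ℝ) : ℝ := G.γ * (vi - ri) * qi

/-- The cost `fᵢ = cᵢ(ξᵢ) - Π(ξᵢ, vᵢ(ξ, p), vᵢʳᵉᶠ)` of DSO `i`, with `cᵢ(t) = Cᵢ t² / 2`. -/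
noncomputable def cost (i : Fin n) (vref ξ : Vec n) : ℝ :=
  1 / 2 * G.C i * ξ i ^ 2 - G.incentive (ξ i) (G.voltage ξ i) (vref i)

/-- `q` is a Nash equilibrium of the DSOs' game with parameter `vref`. -/
def IsNash (vref q : Vec n) : Prop :=
  (∀ i, q i ∈ Set.Icc (G.qlo i) (G.qhi i)) ∧
    ∀ i, ∀ t ∈ Set.Icc (G.qlo i) (G.qhi i),
      G.cost i vref q ≤ G.cost i vref (WithLp.toLp 2 (Function.update q.ofLp i t))

/-- The equilibrium map `q*`; existence and uniqueness of the equilibrium are part of the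
theorem. -/
noncomputable def nashEq (vref : Vec n) : Vec n := Classical.epsilon (G.IsNash vref)

/-- The matrix `C - γ X̃`, where `X̃ = X + diag(X₁₁, …, Xₙₙ)`. -/
noncomputable def jacF : Matrix (Fin n) (Fin n) ℝ :=
  Matrix.diagonal G.C - G.γ • (G.X + Matrix.diagonal G.X.diag)

/-- The pseudo-gradient `Fᵢ = ∇cᵢ(ξᵢ) - γ (vᵢ - vᵢʳᵉᶠ) - γ ξᵢ ∂vᵢ/∂ξᵢ`. -/
noncomputable def pseudoGrad (vref ξ : Vec n) : Vec n :=
  WithLp.toLp 2 fun i =>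
    G.C i * ξ i - G.γ * (G.voltage ξ i - vref i) - G.γ * ξ i * G.X i i

/-! ### The inner loop -/

/-- The point `ξ - η F(vref, ξ)` that the update projects. -/
noncomputable def preProj (η : ℝ) (vref ξ : Vec n) : Vec n := ξ - η • G.pseudoGrad vref ξ

/-- `h(vref, ξ)`: projection of `ξ - η F(vref, ξ)` on the box `∏ [qloᵢ, qhiᵢ]`. -/
noncomputable def h (η : ℝ) (vref ξ : Vec n) : Vec n :=
  WithLp.toLp 2 fun i => max (G.qlo i) (min (G.qhi i) (G.preProj η vref ξ i))

open Classical in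
/-- `∇gᵢ(x) = 1` if `qloᵢ ≤ x ≤ qhiᵢ`, and `0` otherwise. -/
noncomputable def gradProj (i : Fin n) (x : ℝ) : ℝ :=
  if G.qlo i ≤ x ∧ x ≤ G.qhi i then 1 else 0

/-- The diagonal matrix of the `∇gᵢ` at `ξ - η F(vref, ξ)`. -/
noncomputable def gradProjMat (η : ℝ) (vref ξ : Vec n) : Matrix (Fin n) (Fin n) ℝ :=
  Matrix.diagonal fun i => G.gradProj i (G.preProj η vref ξ i)

/-- `J₁h = -η ∇g J₁F`, where `J₁F = γ I`. -/
noncomputable def J1h (η : ℝ) (vref ξ : Vec n) : Matrix (Fin n) (Fin n) ℝ :=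
  -η • (G.gradProjMat η vref ξ * (G.γ • (1 : Matrix (Fin n) (Fin n) ℝ)))

/-- `J₂h = ∇g (I - η J₂F)`, where `J₂F = C - γ X̃`. -/
noncomputable def J2h (η : ℝ) (vref ξ : Vec n) : Matrix (Fin n) (Fin n) ℝ :=
  G.gradProjMat η vref ξ * (1 - η • G.jacF)

/-- One pass of the inner loop: equilibrium seeking step, then sensitivity learning step with the
Jacobians of `h` at the new point. -/
noncomputable def innerStep (η : ℝ) (vref : Vec n)
    (z : Vec n × Matrix (Fin n) (Fin n) ℝ) : Vec n × Matrix (Fin n) (Fin n) ℝ :=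
  (G.h η vref z.1,
    G.J2h η vref (G.h η vref z.1) * z.2 + G.J1h η vref (G.h η vref z.1))

/-- The inner iterates `(ξ̃ˡ, s̃ˡ)` started at `z`. -/
noncomputable def inner (η : ℝ) (vref : Vec n) (z : Vec n × Matrix (Fin n) (Fin n) ℝ) (l : ℕ) :
    Vec n × Matrix (Fin n) (Fin n) ℝ :=
  (G.innerStep η vref)^[l] z

/-- The stopping test after pass `l`:
`max {‖ξ̃ˡ⁺¹ - ξ̃ˡ‖, ‖s̃ˡ⁺¹ - s̃ˡ‖} ≤ σ`. -/
def InnerStop (η : ℝ) (vref : Vec n) (z : Vec n × Matrix (Fin n) (Fin n) ℝ) (σ : ℝ) (l : ℕ) :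
    Prop :=
  max ‖(G.inner η vref z (l + 1)).1 - (G.inner η vref z l).1‖
    (specNorm ((G.inner η vref z (l + 1)).2 - (G.inner η vref z l).2)) ≤ σ

/-- The inner loop started at `z` with tolerance `σ` stops and returns `z'`. -/
def InnerReturns (η : ℝ) (vref : Vec n) (z : Vec n × Matrix (Fin n) (Fin n) ℝ) (σ : ℝ)
    (z' : Vec n × Matrix (Fin n) (Fin n) ℝ) : Prop :=
  ∃ l, G.InnerStop η vref z σ l ∧ (∀ m < l, ¬ G.InnerStop η vref z σ m) ∧
    z' = G.inner η vref z (l + 1)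

/-! ### The relaxed single-level problem -/

/-- The penalty `ϕ(v)`, summed over the buses. -/
noncomputable def penalty (v : Vec n) : ℝ :=
  ∑ i, (G.ρ * max 0 (v i - G.vhi i) ^ 2 + G.ρ * max 0 (G.vlo i - v i) ^ 2)

/-- The gradient of the penalty. -/
noncomputable def gradPenalty (v : Vec n) : Vec n :=
  WithLp.toLp 2 fun i =>
    2 * G.ρ * max 0 (v i - G.vhi i) - 2 * G.ρ * max 0 (G.vlo i - v i)

/-- The augmented objective `φ(vref, v, q)`. -/
noncomputable def objective (vref v q : Vec n) : ℝ :=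
  ∑ i, G.incentive (q i) (v i) (vref i) + G.penalty v

/-- The objective `φ_e(vref) = φ(vref, v(q*(vref), p), q*(vref))` of the relaxed problem. -/
noncomputable def phiE (vref : Vec n) : ℝ :=
  G.objective vref (G.voltage (G.nashEq vref)) (G.nashEq vref)

/-- The hypergradient formula
`∇₁φ + (X s)ᵀ ∇₂φ + sᵀ ∇₃φ` at `(vref, v(ξ, p), ξ)` with the sensitivity `s`. -/
noncomputable def hypergrad (vref ξ : Vec n) (s : Matrix (Fin n) (Fin n) ℝ) : Vec n :=
  WithLp.toLp 2 fun i =>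
    -G.γ * ξ i
      + ((G.X * s)ᵀ *ᵥ fun j => G.γ * ξ j + G.gradPenalty (G.voltage ξ) j) i
      + (sᵀ *ᵥ fun j => G.γ * (G.voltage ξ j - vref j)) i

/-! ### The outer loop -/

/-- `(vref, ξ, s)` is an infinite run of the incentive-update algorithm. In round `k` the inner
loop, warm-started at `(ξᵏ, sᵏ)`, returns `(ξᵏ⁺¹, sᵏ⁺¹)`; then `vref` is updated along the
approximate hypergradient, which is evaluated at `(ξᵏ, sᵏ)` if `d = 0`, and at the estimates
`(ξᵏ⁺¹, sᵏ⁺¹)` just returned if `d = 1`. -/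
structure IsRun (d : Fin 2) (η : ℝ) (ε σ : ℕ → ℝ) (vref ξ : ℕ → Vec n)
    (s : ℕ → Matrix (Fin n) (Fin n) ℝ) : Prop where
  inner_loop : ∀ k, G.InnerReturns η (vref k) (ξ k, s k) (σ k) (ξ (k + 1), s (k + 1))
  update : ∀ k, vref (k + 1) =
    vref k - ε k • G.hypergrad (vref k) (ξ (k + (d : ℕ))) (s (k + (d : ℕ)))

end GridGame

/-- The Clarke subdifferential of a locally Lipschitz function on `ℝⁿ`: the convex hull of all
limits of gradients at nearby points of differentiability. -/
def clarkeSubdiff {n : ℕ} (f : Vec n → ℝ) (x : Vec n) : Set (Vec n) :=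
  convexHull ℝ {g | ∃ u : ℕ → Vec n, Tendsto u atTop (𝓝 x) ∧
    (∀ m, DifferentiableAt ℝ f (u m)) ∧ Tendsto (fun m => gradient f (u m)) atTop (𝓝 g)}

/-- Critical points: `0 ∈ ∂f(x)`. -/
def IsCritical {n : ℕ} (f : Vec n → ℝ) (x : Vec n) : Prop := 0 ∈ clarkeSubdiff f x

/-- The Jacobian matrix of `f` at `x`. -/
noncomputable def jacobian {n : ℕ} (f : Vec n → Vec n) (x : Vec n) : Matrix (Fin n) (Fin n) ℝ :=
  Matrix.of fun i j => fderiv ℝ f x (EuclideanSpace.single j 1) i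

/-- Suitable step sizes: positive, vanishing, not summable. -/
def IsStepSeq (ε : ℕ → ℝ) : Prop :=
  (∀ k, 0 < ε k) ∧ Tendsto ε atTop (𝓝 0) ∧ ¬ Summable ε

/-- Suitable tolerances: positive and vanishing. -/
def IsTolSeq (σ : ℕ → ℝ) : Prop := (∀ k, 0 < σ k) ∧ Tendsto σ atTop (𝓝 0)

/-! ### Matrices as operators on Euclidean space; projected scalar quadratics -/

open scoped RealInnerProductSpace

/-! Write `M` for `jacF`. The projected gradient step has linear part `I - η M`, of norm at most `θ
< 1`, and box projection is nonexpansive. Each cost is convex quadratic in the player's own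
variable, so Nash equilibria are the fixed points of this contraction: parts 1 and 2.

The equilibrium is piecewise affine in the reference. The value before projection, `nashPre`, is a
homeomorphic change of the reference with inverse `refOfPre`, and in it the kinks are the coordinate
hyperplanes through the box limits. A 0/1 pattern `χ` of free coordinates selects a piece with
Jacobian `sens η χ`, the fixed point of the sensitivity recursion with that pattern. Near a kink the
recursion may switch between patterns, but where the equilibrium is differentiable all admissible
patterns have the same Jacobian, and each pass contracts towards it: part 3. Without
differentiability, a loop that stops still has errors at most `σ / (1 - θ)`, with the sensitivity
compared to that of the pattern last used (`innerReturns_approx`).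

Thus every run is a descent with vanishing steps along directions asymptotically close to gradients
of active smooth pieces of `φ_e`. Limits of late stretches of the run are Lipschitz curves with
`-x'` in the convex hull of these gradients (`exists_limit_curve`). At almost every time all active
pieces have the same derivative along the curve (`hasDerivAt_phiE_comp`), so `(φ_e ∘ x)' = -‖x'‖²`
and `φ_e` falls strictly from noncritical points. Critical values are finitely many, because `φ_e`
is quadratic on finitely many cells (`finite_critical_values`). Hence the values cannot cross
upwards infinitely often from a noncritical level, so they converge, and a noncritical accumulation
point would force a further drop.

Boundedness of the run is not assumed. When a coordinate of the reference is large, the projection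
is saturated there: its row of the sensitivity vanishes and its column decays geometrically, while
the term `-γ ξᵢ` does not push outwards because the box contains zero.

For part 5, degenerate equilibria lie over finitely many hyperplanes. Almost every start avoids
them, and the step sizes can be chosen so that all iterates do. -/

/-- The operator on Euclidean space given by a square matrix. -/
noncomputable abbrev matOp {n : ℕ} (A : Matrix (Fin n) (Fin n) ℝ) : Vec n →L[ℝ] Vec n :=
  Matrix.toEuclideanCLM (n := Fin n) (𝕜 := ℝ) A

theorem matOp_apply {n : ℕ} (A : Matrix (Fin n) (Fin n) ℝ) (x : Vec n) (i : Fin n) :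
    matOp A x i = (A *ᵥ x.ofLp) i := rfl

theorem specNorm_eq_norm_matOp {n : ℕ} (A : Matrix (Fin n) (Fin n) ℝ) :
    specNorm A = ‖matOp A‖ := rfl

theorem norm_le_norm_of_abs_le {n : ℕ} {x y : Vec n} (hxy : ∀ i, |x i| ≤ |y i|) : ‖x‖ ≤ ‖y‖ := by
  rw [EuclideanSpace.norm_eq, EuclideanSpace.norm_eq]
  apply Real.sqrt_le_sqrt
  apply Finset.sum_le_sum
  intro i _
  simpa using sq_le_sq.mpr (by simpa using hxy i)

theorem abs_apply_le_norm {n : ℕ} (x : Vec n) (i : Fin n) : |x i| ≤ ‖x‖ := by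
  simpa using PiLp.norm_apply_le x i

/-- Coordinatewise multiplication by a pattern. -/
noncomputable def maskOp {n : ℕ} (χ : Fin n → ℝ) : Vec n →L[ℝ] Vec n := matOp (Matrix.diagonal χ)

theorem maskOp_apply {n : ℕ} (χ : Fin n → ℝ) (x : Vec n) (i : Fin n) :
    maskOp χ x i = χ i * x i := by
  simp [maskOp, matOp_apply, Matrix.mulVec_diagonal]

theorem norm_maskOp_apply_le {n : ℕ} {χ : Fin n → ℝ} (hχ : ∀ i, |χ i| ≤ 1) (x : Vec n) :
    ‖maskOp χ x‖ ≤ ‖x‖ := by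
  apply norm_le_norm_of_abs_le
  intro i
  rw [maskOp_apply, abs_mul]
  exact mul_le_of_le_one_left (abs_nonneg _) (hχ i)

/-- Optimality of a scalar convex quadratic on an interval, as a projected fixed point. -/
theorem quadratic_min_iff_proj_fixed {lo hi m η F q : ℝ} (hlh : lo ≤ hi) (hm : 0 < m)
    (hη : 0 < η) :
    (q ∈ Set.Icc lo hi ∧ ∀ t ∈ Set.Icc lo hi, 0 ≤ F * (t - q) + 1 / 2 * m * (t - q) ^ 2) ↔
      max lo (min hi (q - η * F)) = q := by
  constructor
  · rintro ⟨⟨h1, h2⟩, hopt⟩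
    rcases lt_trichotomy F 0 with hF | hF | hF
    · have hq : q = hi := by
        by_contra hne
        have hlt : q < hi := lt_of_le_of_ne h2 hne
        -- A feasible move of length at most `-F / m` keeps the quadratic term at half the linear
        -- gain or less.
        have hd : 0 < min (hi - q) (-F / m) := lt_min (by linarith) (div_pos (by linarith) hm)
        set d := min (hi - q) (-F / m)
        have hd1 : d ≤ hi - q := min_le_left _ _
        have hd2 : d * m ≤ -F := (le_div_iff₀ hm).mp (min_le_right _ _)
        have := hopt (q + d) ⟨by linarith, by linarith⟩
        have h3 : F + 1 / 2 * m * d < 0 := by nlinarith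
        nlinarith [mul_pos hd (neg_pos.mpr h3)]
      have : η * F < 0 := mul_neg_of_pos_of_neg hη hF
      rw [min_eq_left (by linarith), max_eq_right hlh, hq]
    · subst hF
      simp [h1, h2]
    · have hq : q = lo := by
        by_contra hne
        have hlt : lo < q := lt_of_le_of_ne h1 (Ne.symm hne)
        have hd : 0 < min (q - lo) (F / m) := lt_min (by linarith) (div_pos (by linarith) hm)
        set d := min (q - lo) (F / m)
        have hd1 : d ≤ q - lo := min_le_left _ _
        have hd2 : d * m ≤ F := (le_div_iff₀ hm).mp (min_le_right _ _)
        have := hopt (q - d) ⟨by linarith, by linarith⟩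
        have h3 : 0 < F - 1 / 2 * m * d := by nlinarith
        nlinarith [mul_pos hd h3]
      have : 0 < η * F := mul_pos hη hF
      rw [min_eq_right (by linarith), max_eq_left (by linarith), hq]
  · intro hfix
    have h1 : lo ≤ q := by rw [← hfix]; exact le_max_left _ _
    have h2 : q ≤ hi := by rw [← hfix]; exact max_le hlh (min_le_left _ _)
    refine ⟨⟨h1, h2⟩, fun t ⟨ht1, ht2⟩ => ?_⟩
    have hsq : 0 ≤ 1 / 2 * m * (t - q) ^ 2 := by positivity
    suffices 0 ≤ F * (t - q) by linarith
    rcases lt_trichotomy F 0 with hF | hF | hF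
    · have h3 : η * F < 0 := mul_neg_of_pos_of_neg hη hF
      have hq : q = hi := by
        by_contra hne
        have : q < min hi (q - η * F) := lt_min (lt_of_le_of_ne h2 hne) (by linarith)
        have := le_max_right lo (min hi (q - η * F))
        linarith
      nlinarith
    · simp [hF]
    · have h3 : 0 < η * F := mul_pos hη hF
      have hq : q = lo := by
        by_contra hne
        have h4 : lo < q := lt_of_le_of_ne h1 (Ne.symm hne)
        have h5 : min hi (q - η * F) < q := lt_of_le_of_lt (min_le_right _ _) (by linarith)
        have := max_lt h4 h5
        linarith
      nlinarith

/-! ### The contraction and the Nash equilibrium as its fixed point -/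

namespace GridGame

variable {n : ℕ} (G : GridGame n)

/-- The part of the pseudo-gradient independent of the play and of the reference, negated. -/
noncomputable def offset : Vec n := WithLp.toLp 2 fun i => G.γ * ((G.R *ᵥ G.p) i + G.v₀ i)

/-- The linear part `I - η (C - γ X̃)` of the gradient step. -/
noncomputable def stepOp (η : ℝ) : Vec n →L[ℝ] Vec n := 1 - η • matOp G.jacF

theorem jacF_mulVec (x : Fin n → ℝ) (i : Fin n) :
    (G.jacF *ᵥ x) i = G.C i * x i - G.γ * ((G.X *ᵥ x) i + G.X i i * x i) := by
  simp [jacF, Matrix.sub_mulVec, Matrix.smul_mulVec, Matrix.add_mulVec, Matrix.mulVec_diagonal]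
  ring

theorem pseudoGrad_eq (r ξ : Vec n) :
    G.pseudoGrad r ξ = matOp G.jacF ξ + G.γ • r - G.offset := by
  ext i
  simp [pseudoGrad, offset, voltage, jacF_mulVec]
  ring

theorem preProj_eq (η : ℝ) (r ξ : Vec n) :
    G.preProj η r ξ = G.stepOp η ξ - (η * G.γ) • r + η • G.offset := by
  rw [preProj, pseudoGrad_eq, stepOp]
  simp only [_root_.sub_apply, one_apply_eq_self, _root_.smul_apply]
  module

/-- Projection on the box of reactive power limits. -/
noncomputable def boxProj (y : Vec n) : Vec n :=
  WithLp.toLp 2 fun i => max (G.qlo i) (min (G.qhi i) (y i))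

theorem boxProj_apply (y : Vec n) (i : Fin n) :
    G.boxProj y i = max (G.qlo i) (min (G.qhi i) (y i)) := rfl

theorem h_eq_boxProj (η : ℝ) (r ξ : Vec n) : G.h η r ξ = G.boxProj (G.preProj η r ξ) := rfl

theorem norm_boxProj_sub_le (y y' : Vec n) : ‖G.boxProj y - G.boxProj y'‖ ≤ ‖y - y'‖ := by
  apply norm_le_norm_of_abs_le
  intro i
  simp only [PiLp.sub_apply, boxProj_apply]
  refine (abs_max_sub_max_le_max _ _ _ _).trans ?_
  refine max_le (by simp) ((abs_min_sub_min_le_max _ _ _ _).trans (max_le (by simp) le_rfl))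

theorem continuous_boxProj : Continuous G.boxProj :=
  (LipschitzWith.of_dist_le_mul (K := 1) fun y y' => by
    simpa [dist_eq_norm] using G.norm_boxProj_sub_le y y').continuous

/-- The quantitative consequences of the assumptions on the game: the gradient step contracts by
the factor `θ`, and the game is strongly monotone. -/
structure IsContractive (η θ : ℝ) : Prop where
  γ_pos : 0 < G.γ
  η_pos : 0 < η
  box : ∀ i, G.qlo i < G.qhi i
  nonneg : 0 ≤ θ
  lt_one : θ < 1
  norm_stepOp_le : ∀ x, ‖G.stepOp η x‖ ≤ θ * ‖x‖
  inner_pos : ∀ x : Vec n, x ≠ 0 → 0 < ⟪x, matOp G.jacF x⟫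

variable {G} {η θ : ℝ}

namespace IsContractive

variable (hG : G.IsContractive η θ)
include hG

/-- A diagonal entry of a positive definite matrix. It is the curvature of the cost of DSO `i` in
its own variable, since `ξᵢ` also moves `vᵢ`. -/
theorem jacF_diag_pos (i : Fin n) : 0 < G.C i - 2 * G.γ * G.X i i := by
  have h := hG.inner_pos (EuclideanSpace.single i 1) (by simp)
  rw [EuclideanSpace.inner_single_left] at h
  rw [matOp_apply, jacF_mulVec] at h
  simp at h
  linarith

theorem norm_preProj_sub_le (r r' ξ ξ' : Vec n) :
    ‖G.preProj η r ξ - G.preProj η r' ξ'‖ ≤ θ * ‖ξ - ξ'‖ + η * G.γ * ‖r - r'‖ := by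
  have : G.preProj η r ξ - G.preProj η r' ξ' = G.stepOp η (ξ - ξ') - (η * G.γ) • (r - r') := by
    rw [preProj_eq, preProj_eq, map_sub]
    module
  rw [this]
  refine (norm_sub_le _ _).trans (add_le_add (hG.norm_stepOp_le _) ?_)
  rw [norm_smul, Real.norm_of_nonneg (mul_pos hG.η_pos hG.γ_pos).le]

theorem norm_h_sub_le (r r' ξ ξ' : Vec n) :
    ‖G.h η r ξ - G.h η r' ξ'‖ ≤ θ * ‖ξ - ξ'‖ + η * G.γ * ‖r - r'‖ :=
  (G.norm_boxProj_sub_le _ _).trans (hG.norm_preProj_sub_le r r' ξ ξ')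

/-- A unilateral deviation changes the cost by an exact quadratic with slope `Fᵢ` and curvature `Mᵢᵢ
> 0`, so best response is a scalar projection condition, separately in each coordinate. -/
theorem isNash_iff (r q : Vec n) : G.IsNash r q ↔ G.h η r q = q := by
  have key : ∀ i t, G.cost i r (WithLp.toLp 2 (Function.update q.ofLp i t)) - G.cost i r q =
      G.pseudoGrad r q i * (t - q i) + 1 / 2 * (G.C i - 2 * G.γ * G.X i i) * (t - q i) ^ 2 := by
    intro i t
    have hv : (G.X *ᵥ Function.update q.ofLp i t) i = (G.X *ᵥ q.ofLp) i + G.X i i * (t - q i) := by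
      have : Function.update q.ofLp i t = q.ofLp + Pi.single i (t - q i) := by
        ext j
        by_cases hj : j = i
        · subst hj; simp
        · simp [hj]
      rw [this, Matrix.mulVec_add]
      simp
    simp only [cost, incentive, voltage, pseudoGrad, hv, Function.update_self]
    ring
  have hq : ∀ i, (q i ∈ Set.Icc (G.qlo i) (G.qhi i) ∧ ∀ t ∈ Set.Icc (G.qlo i) (G.qhi i),
      G.cost i r q ≤ G.cost i r (WithLp.toLp 2 (Function.update q.ofLp i t))) ↔
      G.h η r q i = q i := by
    intro i
    rw [h_eq_boxProj, boxProj_apply]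
    have e : G.preProj η r q i = q i - η * G.pseudoGrad r q i := by simp [preProj]
    rw [e, ← quadratic_min_iff_proj_fixed (hG.box i).le (hG.jacF_diag_pos i) hG.η_pos]
    simp only [← key, sub_nonneg]
  constructor
  · intro hN
    ext i
    exact (hq i).mp ⟨hN.1 i, hN.2 i⟩
  · intro hfix
    have := fun i => (hq i).mpr (by rw [hfix])
    exact ⟨fun i => (this i).1, fun i => (this i).2⟩

theorem eq_of_fixed {r q q' : Vec n} (h1 : G.h η r q = q) (h2 : G.h η r q' = q') : q = q' := by
  have h := hG.norm_h_sub_le r r q q'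
  rw [h1, h2, sub_self, norm_zero, mul_zero, add_zero] at h
  have : ‖q - q'‖ = 0 := by
    nlinarith [norm_nonneg (q - q'), hG.lt_one]
  rwa [norm_eq_zero, sub_eq_zero] at this

theorem exists_fixed (r : Vec n) : ∃ q, G.h η r q = q := by
  have hc : ContractingWith (Real.toNNReal θ) (G.h η r) := by
    refine ⟨by simpa using hG.lt_one, LipschitzWith.of_dist_le_mul fun x y => ?_⟩
    rw [dist_eq_norm, dist_eq_norm, Real.coe_toNNReal _ hG.nonneg]
    simpa using hG.norm_h_sub_le r r x y
  exact ⟨_, hc.fixedPoint_isFixedPt⟩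

theorem isNash_nashEq (r : Vec n) : G.IsNash r (G.nashEq r) := by
  obtain ⟨q, hq⟩ := hG.exists_fixed r
  exact Classical.epsilon_spec ⟨q, (hG.isNash_iff r q).mpr hq⟩

theorem h_nashEq (r : Vec n) : G.h η r (G.nashEq r) = G.nashEq r :=
  (hG.isNash_iff _ _).mp (hG.isNash_nashEq r)

theorem eq_nashEq {r q : Vec n} (h : G.h η r q = q) : q = G.nashEq r :=
  hG.eq_of_fixed h (hG.h_nashEq r)

theorem isNash_iff_eq (r q : Vec n) : G.IsNash r q ↔ q = G.nashEq r :=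
  ⟨fun h => hG.eq_nashEq ((hG.isNash_iff _ _).mp h), fun h => h ▸ hG.isNash_nashEq r⟩

theorem norm_inner_sub_nashEq_le (r : Vec n) (z : Vec n × Matrix (Fin n) (Fin n) ℝ) (l : ℕ) :
    ‖(G.inner η r z l).1 - G.nashEq r‖ ≤ θ ^ l * ‖z.1 - G.nashEq r‖ := by
  induction l with
  | zero => simp [GridGame.inner]
  | succ l ih =>
    have e : (G.inner η r z (l + 1)).1 = G.h η r (G.inner η r z l).1 := by
      simp [GridGame.inner, Function.iterate_succ_apply', innerStep]
    rw [e]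
    nth_rewrite 1 [← hG.h_nashEq r]
    refine (hG.norm_h_sub_le r r _ _).trans ?_
    rw [sub_self, norm_zero, mul_zero, add_zero, pow_succ', mul_assoc]
    exact mul_le_mul_of_nonneg_left ih hG.nonneg

end IsContractive

/-- Symmetry turns the eigenvalue bound into `μ ‖x‖² ≤ ⟪x, M x⟫`. The factor then comes from
expanding `‖x - η M x‖²` and using `‖M x‖ ≤ L ‖x‖`. -/
theorem isContractive_of_spectrum (G : GridGame n) {μ η : ℝ} (hX : G.X.IsSymm) (hγ : 0 < G.γ)
    (hbox : ∀ i, G.qlo i < G.qhi i) (hμ : 0 < μ) (hmin : ∀ t ∈ spectrum ℝ G.jacF, μ ≤ t)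
    (hη : 0 < η) (hηL : η * specNorm G.jacF ^ 2 < 2 * μ) :
    G.IsContractive η (Real.sqrt (1 - η * (2 * μ - η * specNorm G.jacF ^ 2))) := by
  have hsymm : G.jacF.IsHermitian := by
    have : G.jacF.IsSymm := by
      unfold jacF
      refine (Matrix.isSymm_diagonal _).sub (Matrix.IsSymm.smul (hX.add (Matrix.isSymm_diagonal _)) _)
    rwa [Matrix.IsHermitian, Matrix.conjTranspose_eq_transpose_of_trivial]
  have hps : (G.jacF - algebraMap ℝ (Matrix (Fin n) (Fin n) ℝ) μ).PosSemidef := by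
    rw [Matrix.posSemidef_iff_isHermitian_and_spectrum_nonneg]
    refine ⟨hsymm.sub ?_, ?_⟩
    · rw [Matrix.algebraMap_eq_diagonal]
      exact Matrix.isHermitian_diagonal _
    · intro t ht
      rw [← spectrum.sub_singleton_eq] at ht
      obtain ⟨s, hs, u, hu, rfl⟩ := ht
      have := hmin s hs
      simp only [Set.mem_singleton_iff] at hu
      simp only [Set.mem_ofPred_eq]
      linarith
  have hmono : ∀ x : Vec n, μ * ‖x‖ ^ 2 ≤ ⟪x, matOp G.jacF x⟫ := by
    intro x
    have h1 := hps.dotProduct_mulVec_nonneg x.ofLp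
    have h2 : ⟪x, matOp (G.jacF - algebraMap ℝ (Matrix (Fin n) (Fin n) ℝ) μ) x⟫
        = ⟪x, matOp G.jacF x⟫ - μ * ‖x‖ ^ 2 := by
      rw [matOp, map_sub, AlgHomClass.commutes]
      simp [inner_sub_right, Algebra.algebraMap_eq_smul_one, inner_smul_right]
    rw [Matrix.inner_toEuclideanCLM] at h2
    have h3 : star x.ofLp = x.ofLp := by ext; simp
    rw [h3] at h1
    linarith
  refine ⟨hγ, hη, hbox, Real.sqrt_nonneg _, ?_, fun x => ?_, fun x hx => ?_⟩
  · rw [Real.sqrt_lt' one_pos]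
    nlinarith
  · have h1 := hmono x
    have h2 : ‖matOp G.jacF x‖ ≤ specNorm G.jacF * ‖x‖ := (matOp G.jacF).le_opNorm x
    have h3 : ‖G.stepOp η x‖ ^ 2 ≤
        (1 - η * (2 * μ - η * specNorm G.jacF ^ 2)) * ‖x‖ ^ 2 := by
      have : G.stepOp η x = x - η • matOp G.jacF x := by simp [stepOp]
      rw [this, norm_sub_sq_real, inner_smul_right, norm_smul, Real.norm_of_nonneg hη.le]
      have h4 : ‖matOp G.jacF x‖ ^ 2 ≤ (specNorm G.jacF * ‖x‖) ^ 2 :=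
        pow_le_pow_left₀ (norm_nonneg _) h2 2
      nlinarith [mul_le_mul_of_nonneg_left h1 hη.le,
        mul_le_mul_of_nonneg_left h4 (sq_nonneg η)]
    rw [← Real.sqrt_sq (norm_nonneg (G.stepOp η x))]
    refine (Real.sqrt_le_sqrt h3).trans ?_
    rw [Real.sqrt_mul' _ (sq_nonneg _), Real.sqrt_sq (norm_nonneg x)]
  · exact lt_of_lt_of_le (mul_pos hμ (pow_pos (norm_pos_iff.mpr hx) 2)) (hmono x)

end GridGame

/-! ### The piecewise affine equilibrium map: patterns, sensitivities, differentiability -/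

namespace GridGame

variable {n : ℕ} (G : GridGame n)

/-- The `0/1` pattern `∇g` of the coordinates of `y` that lie in the box. -/
noncomputable def pattern (y : Vec n) : Fin n → ℝ := fun i => G.gradProj i (y i)

/-- The patterns that occur arbitrarily near `y` on sets with nonempty interior. -/
def admissible (y : Vec n) : Set (Fin n → ℝ) :=
  {χ | ∀ i, (χ i = 1 ∧ G.qlo i ≤ y i ∧ y i ≤ G.qhi i) ∨ (χ i = 0 ∧ (y i ≤ G.qlo i ∨ G.qhi i ≤ y i))}

theorem pattern_eq_or (y : Vec n) (i : Fin n) :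
    (G.pattern y i = 1 ∧ G.qlo i ≤ y i ∧ y i ≤ G.qhi i) ∨
      (G.pattern y i = 0 ∧ (y i < G.qlo i ∨ G.qhi i < y i)) := by
  unfold pattern gradProj
  split_ifs with h
  · exact Or.inl ⟨rfl, h⟩
  · refine Or.inr ⟨rfl, ?_⟩
    by_contra! hc
    exact h hc

theorem pattern_mem_admissible (y : Vec n) : G.pattern y ∈ G.admissible y := by
  intro i
  rcases G.pattern_eq_or y i with h | ⟨h, h'⟩
  · exact Or.inl h
  · exact Or.inr ⟨h, h'.imp le_of_lt le_of_lt⟩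

theorem finite_admissible (y : Vec n) : (G.admissible y).Finite := by
  refine (Set.Finite.pi (t := fun _ : Fin n => ({0, 1} : Set ℝ)) fun _ => by simp).subset ?_
  intro χ hχ i _
  rcases hχ i with h | h <;> simp [h.1]

theorem abs_le_one_of_mem_admissible {y : Vec n} {χ : Fin n → ℝ} (hχ : χ ∈ G.admissible y)
    (i : Fin n) : |χ i| ≤ 1 := by
  rcases hχ i with h | h <;> simp [h.1]

/-- Upper semicontinuity: a pattern is excluded at `y` by strict inequalities, which persist nearby.
-/
theorem eventually_admissible_subset (y : Vec n) :
    ∀ᶠ y' in 𝓝 y, G.admissible y' ⊆ G.admissible y := by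
  have hc : ∀ i, Tendsto (fun y' : Vec n => y' i) (𝓝 y) (𝓝 (y i)) := fun i =>
    (by fun_prop : Continuous fun y' : Vec n => y' i).tendsto y
  have h1 : ∀ᶠ y' in 𝓝 y, ∀ i, (y i < G.qlo i → y' i < G.qlo i) ∧ (G.qlo i < y i → G.qlo i < y' i) ∧
      (y i < G.qhi i → y' i < G.qhi i) ∧ (G.qhi i < y i → G.qhi i < y' i) := by
    rw [Filter.eventually_all]
    intro i
    refine Filter.Eventually.and ?_ (Filter.Eventually.and ?_ (Filter.Eventually.and ?_ ?_)) <;>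
      rw [Filter.eventually_imp_distrib_left] <;> intro h
    · exact (hc i).eventually_lt_const h
    · exact (hc i).eventually_const_lt h
    · exact (hc i).eventually_lt_const h
    · exact (hc i).eventually_const_lt h
  filter_upwards [h1] with y' hy' χ hχ i
  obtain ⟨ha, hb, hc, hd⟩ := hy' i
  rcases hχ i with ⟨h, h2, h3⟩ | ⟨h, h2⟩
  · refine Or.inl ⟨h, ?_, ?_⟩
    · by_contra! hlt
      linarith [ha hlt]
    · by_contra! hlt
      linarith [hd hlt]
  · refine Or.inr ⟨h, ?_⟩
    by_contra! hlt
    rcases h2 with h2 | h2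
    · linarith [hb hlt.1]
    · linarith [hc hlt.2]

/-- The sensitivity of the equilibrium on the region with pattern `χ`, i.e. the solution `J` of
`J = χ ((I - η M) J - η γ I)`. -/
noncomputable def sens (η : ℝ) (χ : Fin n → ℝ) : Vec n →L[ℝ] Vec n :=
  Ring.inverse (1 - maskOp χ * G.stepOp η) * (-(η * G.γ) • maskOp χ)

/-- The equilibrium as the value before the projection. -/
noncomputable def nashPre (η : ℝ) (r : Vec n) : Vec n := G.preProj η r (G.nashEq r)

/-- The reference at which the equilibrium gives the value `y` before the projection. -/
noncomputable def refOfPre (η : ℝ) (y : Vec n) : Vec n :=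
  (η * G.γ)⁻¹ • (G.stepOp η (G.boxProj y) - y + η • G.offset)

theorem continuous_refOfPre (η : ℝ) : Continuous (G.refOfPre η) := by
  have := G.continuous_boxProj
  unfold refOfPre
  fun_prop

variable {G} {η θ : ℝ}

namespace IsContractive

variable (hG : G.IsContractive η θ)
include hG

theorem boxProj_nashPre (r : Vec n) : G.boxProj (G.nashPre η r) = G.nashEq r := hG.h_nashEq r

theorem ηγ_pos : 0 < η * G.γ := mul_pos hG.η_pos hG.γ_pos

/-- The reference enters the gradient step only through the shift `-(η γ) r`, so one can solve for
it. This makes every `y` a value of `nashPre` and lets perturbations be prescribed in the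
coordinates where the kinks are axis-parallel. -/
theorem preProj_refOfPre (y : Vec n) : G.preProj η (G.refOfPre η y) (G.boxProj y) = y := by
  rw [preProj_eq, refOfPre, smul_smul, mul_inv_cancel₀ hG.ηγ_pos.ne']
  module

theorem nashEq_refOfPre (y : Vec n) : G.nashEq (G.refOfPre η y) = G.boxProj y := by
  symm
  apply hG.eq_nashEq
  rw [h_eq_boxProj, hG.preProj_refOfPre]

theorem nashPre_refOfPre (y : Vec n) : G.nashPre η (G.refOfPre η y) = y := by
  rw [nashPre, hG.nashEq_refOfPre, hG.preProj_refOfPre]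

theorem refOfPre_nashPre (r : Vec n) : G.refOfPre η (G.nashPre η r) = r := by
  rw [refOfPre, hG.boxProj_nashPre, nashPre, preProj_eq]
  have : G.stepOp η (G.nashEq r) - (G.stepOp η (G.nashEq r) - (η * G.γ) • r + η • G.offset) +
    η • G.offset = (η * G.γ) • r := by module
  rw [this, smul_smul, inv_mul_cancel₀ hG.ηγ_pos.ne', one_smul]

theorem norm_nashEq_sub_le (r r' : Vec n) :
    ‖G.nashEq r - G.nashEq r'‖ ≤ η * G.γ / (1 - θ) * ‖r - r'‖ := by
  have h := hG.norm_h_sub_le r r' (G.nashEq r) (G.nashEq r')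
  rw [hG.h_nashEq, hG.h_nashEq] at h
  rw [div_mul_eq_mul_div, le_div_iff₀ (by linarith [hG.lt_one])]
  linarith

theorem lipschitzWith_nashEq :
    LipschitzWith (Real.toNNReal (η * G.γ / (1 - θ))) G.nashEq := by
  refine LipschitzWith.of_dist_le_mul fun r r' => ?_
  rw [dist_eq_norm, dist_eq_norm, Real.coe_toNNReal _
    (div_nonneg hG.ηγ_pos.le (by linarith [hG.lt_one]))]
  exact hG.norm_nashEq_sub_le r r'

theorem continuous_nashEq : Continuous G.nashEq := hG.lipschitzWith_nashEq.continuous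

theorem continuous_nashPre : Continuous (G.nashPre η) := by
  have := hG.continuous_nashEq
  have e : G.nashPre η = fun r => G.stepOp η (G.nashEq r) - (η * G.γ) • r + η • G.offset := by
    ext1 r
    rw [nashPre, preProj_eq]
  rw [e]
  fun_prop

section Sens

variable {χ : Fin n → ℝ} (hχ : ∀ i, |χ i| ≤ 1)
include hχ

theorem norm_maskOp_stepOp_le (x : Vec n) : ‖maskOp χ (G.stepOp η x)‖ ≤ θ * ‖x‖ :=
  (norm_maskOp_apply_le hχ _).trans (hG.norm_stepOp_le x)

theorem isUnit_one_sub : IsUnit (1 - maskOp χ * G.stepOp η) := by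
  have h : ‖(maskOp χ).comp (G.stepOp η)‖ ≤ θ :=
    ContinuousLinearMap.opNorm_le_bound _ hG.nonneg fun x => hG.norm_maskOp_stepOp_le hχ x
  exact isUnit_one_sub_of_norm_lt_one (lt_of_le_of_lt h hG.lt_one)

theorem sens_apply (d : Vec n) :
    G.sens η χ d = maskOp χ (G.stepOp η (G.sens η χ d) - (η * G.γ) • d) := by
  have h := Ring.mul_inverse_cancel _ (hG.isUnit_one_sub hχ)
  have h2 : (1 - maskOp χ * G.stepOp η) * G.sens η χ = -(η * G.γ) • maskOp χ := by
    rw [sens, ← mul_assoc, h, one_mul]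
  have h3 : G.sens η χ d - maskOp χ (G.stepOp η (G.sens η χ d)) = -(η * G.γ) • maskOp χ d :=
    congrArg (fun A : Vec n →L[ℝ] Vec n => A d) h2
  rw [map_sub, map_smul]
  rw [sub_eq_iff_eq_add] at h3
  nth_rewrite 1 [h3]
  module

/-- The linear part of the equation contracts by `θ`, so the solution is unique. Derivatives and
finite increments of the equilibrium are both identified this way. -/
theorem eq_sens_apply {x d : Vec n} (h : x = maskOp χ (G.stepOp η x - (η * G.γ) • d)) :
    x = G.sens η χ d := by
  have h2 : x - G.sens η χ d = maskOp χ (G.stepOp η (x - G.sens η χ d)) := by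
    nth_rewrite 1 [h]
    nth_rewrite 1 [hG.sens_apply hχ d]
    simp only [map_sub]
    abel
  have h3 := hG.norm_maskOp_stepOp_le hχ (x - G.sens η χ d)
  rw [← h2] at h3
  have : ‖x - G.sens η χ d‖ = 0 := by
    nlinarith [norm_nonneg (x - G.sens η χ d), hG.lt_one]
  rwa [norm_eq_zero, sub_eq_zero] at this

/-- If the entry vanished, `x = sens η χ eᵢ` would satisfy `xⱼ = 0` or `(M x)ⱼ = 0` for every `j`.
Then `⟪x, M x⟫ = 0`, so `x = 0`, contradicting the forcing `-η γ` in coordinate `i`. -/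
theorem sens_single_ne_zero {i : Fin n} (hi : χ i = 1) (h01 : ∀ j, χ j = 0 ∨ χ j = 1) :
    G.sens η χ (EuclideanSpace.single i 1) i ≠ 0 := by
  intro h0
  set x := G.sens η χ (EuclideanSpace.single i 1) with hx
  have hfix := hG.sens_apply hχ (EuclideanSpace.single i 1)
  rw [← hx] at hfix
  have hj : ∀ j, x j = χ j * (x j - η * matOp G.jacF x j -
      η * G.γ * (EuclideanSpace.single i 1 : Vec n) j) := by
    intro j
    have := congrArg (fun v : Vec n => v j) hfix
    simp only [maskOp_apply, stepOp] at this
    simpa using this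
  have hinner : ⟪x, matOp G.jacF x⟫ = 0 := by
    rw [PiLp.inner_apply]
    apply Finset.sum_eq_zero
    intro j _
    rcases h01 j with h | h
    · have := hj j
      rw [h, zero_mul] at this
      simp [this]
    · by_cases hji : j = i
      · subst hji
        simp [h0]
      · have := hj j
        rw [h] at this
        simp only [PiLp.single_apply, hji, if_false, mul_zero, sub_zero, one_mul] at this
        have : matOp G.jacF x j = 0 := by
          have h5 : η * matOp G.jacF x j = 0 := by linarith
          exact (mul_eq_zero.mp h5).resolve_left hG.η_pos.ne'
        simp [this]
  have hx0 : x = 0 := by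
    by_contra hne
    exact (hG.inner_pos x hne).ne' hinner
  have := hj i
  rw [hx0, hi] at this
  simp at this
  rcases this with h | h
  · exact hG.η_pos.ne' h
  · exact hG.γ_pos.ne' h

end Sens

/-- Wherever the equilibrium is differentiable along a map, its derivative is given by the
sensitivity of every admissible pattern. -/
theorem hasFDerivAt_nashEq_comp {E : Type*} [NormedAddCommGroup E] [NormedSpace ℝ E]
    {x : E → Vec n} {e : E} {x' q' : E →L[ℝ] Vec n} (hx : HasFDerivAt x x' e)
    (hq : HasFDerivAt (fun a => G.nashEq (x a)) q' e) {χ : Fin n → ℝ}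
    (hχ : χ ∈ G.admissible (G.nashPre η (x e))) : q' = (G.sens η χ).comp x' := by
  have hy : HasFDerivAt (fun a => G.nashPre η (x a))
      ((G.stepOp η).comp q' - (η * G.γ) • x') e := by
    have h1 := (((G.stepOp η).hasFDerivAt.comp e hq).sub (hx.const_smul (η * G.γ))).add_const
      (η • G.offset)
    refine h1.congr_of_eventuallyEq (Eventually.of_forall fun a => ?_)
    simp [nashPre, preProj_eq]
  set y' := (G.stepOp η).comp q' - (η * G.γ) • x' with hy'
  have hyi : ∀ i, HasFDerivAt (fun a => G.nashPre η (x a) i) ((EuclideanSpace.proj i).comp y') e :=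
    fun i => (EuclideanSpace.proj (𝕜 := ℝ) i).hasFDerivAt.comp e hy
  have hqi : ∀ i, HasFDerivAt (fun a => G.nashEq (x a) i) ((EuclideanSpace.proj i).comp q') e :=
    fun i => (EuclideanSpace.proj (𝕜 := ℝ) i).hasFDerivAt.comp e hq
  have hproj : ∀ a i, G.nashEq (x a) i =
      max (G.qlo i) (min (G.qhi i) (G.nashPre η (x a) i)) := by
    intro a i
    nth_rewrite 1 [← hG.boxProj_nashPre (x a)]
    rfl
  have hcoord : ∀ i d, q' d i = χ i * y' d i := by
    intro i d
    set Y := fun a => G.nashPre η (x a) i with hYdef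
    have hYc : ContinuousAt Y e := (hyi i).continuousAt
    have hbox := hG.box i
    -- At a kink this applies twice: the distance of `qᵢ` to the limit and the gap between `qᵢ` and
    -- the unprojected value are nonnegative nearby and vanish at `e`. Hence both derivatives are
    -- zero there, and `q'ᵢ = χᵢ y'ᵢ` whatever `χᵢ` is.
    have hdeg : ∀ g : E → ℝ, (∀ᶠ a in 𝓝 e, 0 ≤ g a) → g e = 0 → ∀ g' : E →L[ℝ] ℝ,
        HasFDerivAt g g' e → g' = 0 := by
      intro g hg hge g' hg'
      refine IsLocalMin.hasFDerivAt_eq_zero ?_ hg'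
      filter_upwards [hg] with a ha
      rw [hge]
      exact ha
    rcases lt_trichotomy (Y e) (G.qlo i) with hlo | hlo | hlo
    · have hχi : χ i = 0 := by
        rcases hχ i with h | h
        · exact absurd hlo (not_lt.mpr h.2.1)
        · exact h.1
      have h1 : HasFDerivAt (fun a => G.nashEq (x a) i) (0 : E →L[ℝ] ℝ) e := by
        refine (hasFDerivAt_const (G.qlo i) e).congr_of_eventuallyEq ?_
        filter_upwards [hYc.eventually_lt_const hlo] with a ha
        rw [hproj, min_eq_right (ha.le.trans hbox.le), max_eq_left ha.le]
      have h2 := congrArg (fun A : E →L[ℝ] ℝ => A d) ((hqi i).unique h1)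
      simpa [hχi] using h2
    · have h1 := hdeg (fun a => G.nashEq (x a) i - G.qlo i)
        (Eventually.of_forall fun a => by
          rw [hproj]
          exact sub_nonneg.mpr (le_max_left _ _))
        (by
          rw [hproj, min_eq_right (hlo.trans_le hbox.le), max_eq_left hlo.le, sub_self])
        _ ((hqi i).sub_const _)
      have h2 := hdeg (fun a => G.nashEq (x a) i - Y a)
        (by
          filter_upwards [hYc.eventually_lt_const (hlo ▸ hbox : Y e < G.qhi i)] with a ha
          rw [hproj, min_eq_right ha.le]
          exact sub_nonneg.mpr (le_max_right _ _))
        (by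
          rw [hproj, min_eq_right (hlo.trans_le hbox.le)]
          change max (G.qlo i) (Y e) - Y e = 0
          rw [max_eq_left hlo.le, hlo, sub_self])
        _ ((hqi i).sub (hyi i))
      have h3 := congrArg (fun A : E →L[ℝ] ℝ => A d) h1
      have h4 := congrArg (fun A : E →L[ℝ] ℝ => A d) h2
      simp at h3 h4
      rw [h3] at h4 ⊢
      have : y' d i = 0 := by linarith
      rw [this, mul_zero]
    · rcases lt_trichotomy (Y e) (G.qhi i) with hhi | hhi | hhi
      · have hχi : χ i = 1 := by
          rcases hχ i with h | h
          · exact h.1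
          · rcases h.2 with h | h
            · exact absurd hlo (not_lt.mpr h)
            · exact absurd hhi (not_lt.mpr h)
        have h1 : HasFDerivAt (fun a => G.nashEq (x a) i) ((EuclideanSpace.proj i).comp y') e := by
          refine (hyi i).congr_of_eventuallyEq ?_
          filter_upwards [hYc.eventually_lt_const hhi, hYc.eventually_const_lt hlo] with a ha hb
          rw [hproj, min_eq_right ha.le, max_eq_right hb.le]
        have h2 := congrArg (fun A : E →L[ℝ] ℝ => A d) ((hqi i).unique h1)
        simpa [hχi] using h2
      · have h1 := hdeg (fun a => G.qhi i - G.nashEq (x a) i)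
          (Eventually.of_forall fun a => by
            rw [hproj]
            exact sub_nonneg.mpr (max_le hbox.le (min_le_left _ _)))
          (by
            rw [hproj, min_eq_left hhi.ge, max_eq_right hbox.le, sub_self])
          _ ((hqi i).const_sub _)
        have h2 := hdeg (fun a => Y a - G.nashEq (x a) i)
          (by
            filter_upwards [hYc.eventually_const_lt hlo] with a ha
            rw [hproj]
            exact sub_nonneg.mpr (max_le ha.le (min_le_right _ _)))
          (by
            rw [hproj, min_eq_left hhi.ge, max_eq_right hbox.le, hhi, sub_self])
          _ ((hyi i).sub (hqi i))
        have h3 := congrArg (fun A : E →L[ℝ] ℝ => A d) h1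
        have h4 := congrArg (fun A : E →L[ℝ] ℝ => A d) h2
        simp at h3 h4
        rw [h3] at h4 ⊢
        have : y' d i = 0 := by linarith
        rw [this, mul_zero]
      · have hχi : χ i = 0 := by
          rcases hχ i with h | h
          · exact absurd hhi (not_lt.mpr h.2.2)
          · exact h.1
        have h1 : HasFDerivAt (fun a => G.nashEq (x a) i) (0 : E →L[ℝ] ℝ) e := by
          refine (hasFDerivAt_const (G.qhi i) e).congr_of_eventuallyEq ?_
          filter_upwards [hYc.eventually_const_lt hhi] with a ha
          rw [hproj, min_eq_left ha.le, max_eq_right hbox.le]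
        have h2 := congrArg (fun A : E →L[ℝ] ℝ => A d) ((hqi i).unique h1)
        simpa [hχi] using h2
  ext1 d
  refine hG.eq_sens_apply (G.abs_le_one_of_mem_admissible hχ) ?_
  ext i
  rw [maskOp_apply, hcoord i d, hy']
  simp

/-- Under strict complementarity the equilibrium is differentiable, with the sensitivity of its
pattern as derivative. -/
theorem hasFDerivAt_nashEq {r : Vec n} {χ : Fin n → ℝ}
    (hχ : ∀ i, (χ i = 1 ∧ G.qlo i < G.nashPre η r i ∧ G.nashPre η r i < G.qhi i) ∨
      (χ i = 0 ∧ (G.nashPre η r i < G.qlo i ∨ G.qhi i < G.nashPre η r i))) :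
    HasFDerivAt G.nashEq (G.sens η χ) r := by
  have hχ1 : ∀ i, |χ i| ≤ 1 := fun i => by rcases hχ i with h | h <;> simp [h.1]
  have hc : ∀ i, Tendsto (fun a : Vec n => G.nashPre η a i) (𝓝 r) (𝓝 (G.nashPre η r i)) := by
    intro i
    have := hG.continuous_nashPre
    exact (by fun_prop : Continuous fun a : Vec n => G.nashPre η a i).tendsto r
  have hloc : ∀ᶠ a in 𝓝 r, ∀ i, G.nashEq a i - G.nashEq r i =
      χ i * (G.nashPre η a i - G.nashPre η r i) := by
    have hproj : ∀ a i, G.nashEq a i =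
      max (G.qlo i) (min (G.qhi i) (G.nashPre η a i)) := by
      intro a i
      nth_rewrite 1 [← hG.boxProj_nashPre a]
      rfl
    rw [Filter.eventually_all]
    intro i
    have hbox := (hG.box i).le
    rcases hχ i with ⟨h, h1, h2⟩ | ⟨h, h1 | h1⟩
    · filter_upwards [(hc i).eventually_const_lt h1, (hc i).eventually_lt_const h2] with a ha hb
      rw [hproj, hproj, h, min_eq_right hb.le, max_eq_right ha.le, min_eq_right h2.le,
        max_eq_right h1.le, one_mul]
    · filter_upwards [(hc i).eventually_lt_const h1] with a ha
      rw [hproj, hproj, h, min_eq_right (ha.le.trans hbox), max_eq_left ha.le,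
        min_eq_right (h1.le.trans hbox), max_eq_left h1.le, zero_mul, sub_self]
    · filter_upwards [(hc i).eventually_const_lt h1] with a ha
      rw [hproj, hproj, h, min_eq_left ha.le, min_eq_left h1.le, zero_mul, sub_self]
  -- Near `r` the finite increments satisfy the sensitivity equation exactly, so the equilibrium is
  -- locally affine.
  have hlin : ∀ᶠ a in 𝓝 r, G.nashEq a = G.nashEq r + G.sens η χ (a - r) := by
    filter_upwards [hloc] with a ha
    rw [← sub_eq_iff_eq_add']
    refine hG.eq_sens_apply hχ1 ?_
    ext i
    rw [maskOp_apply, PiLp.sub_apply, ha i]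
    congr 1
    simp only [nashPre, preProj_eq, map_sub, PiLp.sub_apply, PiLp.add_apply, PiLp.smul_apply,
      smul_eq_mul]
    ring
  have h1 : HasFDerivAt (fun a => G.nashEq r + G.sens η χ (a - r)) (G.sens η χ) r := by
    have := ((G.sens η χ).hasFDerivAt.comp r ((hasFDerivAt_id r).sub_const r)).const_add
      (G.nashEq r)
    simpa using this
  exact h1.congr_of_eventuallyEq hlin

end IsContractive

end GridGame

/-! ### The inner loop: convergence, stopping accuracy, saturated coordinates -/

section MatOp

variable {n : ℕ} (A B : Matrix (Fin n) (Fin n) ℝ) (x : Vec n)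

theorem matOp_sub : matOp (A - B) = matOp A - matOp B := map_sub _ _ _

theorem matOp_add_apply : matOp (A + B) x = matOp A x + matOp B x := by
  rw [matOp, map_add]; rfl

theorem matOp_mul_apply : matOp (A * B) x = matOp A (matOp B x) := by
  rw [matOp, map_mul]; rfl

theorem matOp_smul_apply (c : ℝ) : matOp (c • A) x = c • matOp A x := by
  rw [matOp, map_smul]; rfl

theorem matOp_one_apply : matOp (1 : Matrix (Fin n) (Fin n) ℝ) x = x := by
  rw [matOp, map_one]; rfl

end MatOp

theorem tendsto_zero_of_eventually_le_mul {u : ℕ → ℝ} {θ : ℝ} (hu : ∀ k, 0 ≤ u k) (h0 : 0 ≤ θ)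
    (h1 : θ < 1) (h : ∀ᶠ k in atTop, u (k + 1) ≤ θ * u k) : Tendsto u atTop (𝓝 0) := by
  obtain ⟨N, hN⟩ := eventually_atTop.mp h
  have hb : ∀ m, u (m + N) ≤ θ ^ m * u N := by
    intro m
    induction m with
    | zero => simp
    | succ m ih =>
      have := hN (m + N) (by omega)
      rw [show m + 1 + N = m + N + 1 by ring, pow_succ', mul_assoc]
      exact this.trans (mul_le_mul_of_nonneg_left ih h0)
  rw [← tendsto_add_atTop_iff_nat N]
  refine squeeze_zero (fun m => hu _) hb ?_
  simpa using (tendsto_pow_atTop_nhds_zero_of_lt_one h0 h1).mul_const (u N)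

namespace GridGame

variable {n : ℕ} (G : GridGame n)

/-- Reactive power profiles within the limits. -/
def InBox (ξ : Vec n) : Prop := ∀ i, ξ i ∈ Set.Icc (G.qlo i) (G.qhi i)

/-- A bound for the norm of the profiles within the limits. -/
noncomputable def boxBound : ℝ :=
  ‖(WithLp.toLp 2 fun i => max |G.qlo i| |G.qhi i| : Vec n)‖

theorem abs_le_boxBound (i : Fin n) : |G.qlo i| ≤ G.boxBound ∧ |G.qhi i| ≤ G.boxBound := by
  have h := abs_apply_le_norm (WithLp.toLp 2 fun i => max |G.qlo i| |G.qhi i| : Vec n) i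
  have h2 := le_abs_self (max |G.qlo i| |G.qhi i|)
  exact ⟨(le_max_left _ _).trans (h2.trans h), (le_max_right _ _).trans (h2.trans h)⟩

variable {G}

theorem InBox.norm_le {ξ : Vec n} (h : G.InBox ξ) : ‖ξ‖ ≤ G.boxBound := by
  apply norm_le_norm_of_abs_le
  intro i
  refine (abs_le_max_abs_abs (h i).1 (h i).2).trans (le_abs_self _)

variable (G)

theorem inner_succ (η : ℝ) (r : Vec n) (z : Vec n × Matrix (Fin n) (Fin n) ℝ) (l : ℕ) :
    G.inner η r z (l + 1) = G.innerStep η r (G.inner η r z l) := by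
  simp [GridGame.inner, Function.iterate_succ_apply']

theorem innerStep_fst (η : ℝ) (r : Vec n) (z : Vec n × Matrix (Fin n) (Fin n) ℝ) :
    (G.innerStep η r z).1 = G.h η r z.1 := rfl

theorem matOp_innerStep_snd (η : ℝ) (r : Vec n) (z : Vec n × Matrix (Fin n) (Fin n) ℝ)
    (d : Vec n) :
    matOp (G.innerStep η r z).2 d =
      maskOp (G.pattern (G.preProj η r (G.innerStep η r z).1))
        (G.stepOp η (matOp z.2 d) - (η * G.γ) • d) := by
  have e : G.gradProjMat η r (G.h η r z.1) =
      Matrix.diagonal (G.pattern (G.preProj η r (G.h η r z.1))) := rfl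
  have e2 : matOp (1 - η • G.jacF) = G.stepOp η := by
    rw [matOp, map_sub, map_one, map_smul]
    rfl
  simp only [innerStep, J2h, J1h, e]
  rw [matOp_add_apply, matOp_mul_apply, matOp_mul_apply, matOp_smul_apply, matOp_mul_apply,
    matOp_smul_apply, matOp_one_apply, e2, ← maskOp, map_sub, map_smul, map_smul]
  module

theorem inBox_h {η : ℝ} (hbox : ∀ i, G.qlo i < G.qhi i) (r ξ : Vec n) : G.InBox (G.h η r ξ) :=
  fun i => ⟨le_max_left _ _, max_le (hbox i).le (min_le_left _ _)⟩

variable {G} {η θ : ℝ}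

theorem abs_pattern_le_one (y : Vec n) (i : Fin n) : |G.pattern y i| ≤ 1 :=
  G.abs_le_one_of_mem_admissible (G.pattern_mem_admissible y) i

namespace IsContractive

variable (hG : G.IsContractive η θ)
include hG

/-- The sensitivity update is affine with a `θ`-contracting linear part, and `sens` of the current
pattern is its fixed point. -/
theorem norm_innerStep_sub_sens_le (r : Vec n) (z : Vec n × Matrix (Fin n) (Fin n) ℝ)
    {J : Vec n →L[ℝ] Vec n}
    (hJ : J = G.sens η (G.pattern (G.preProj η r (G.innerStep η r z).1))) :
    ‖matOp (G.innerStep η r z).2 - J‖ ≤ θ * ‖matOp z.2 - J‖ := by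
  refine ContinuousLinearMap.opNorm_le_bound _ (mul_nonneg hG.nonneg (norm_nonneg _)) fun d => ?_
  have e : (matOp (G.innerStep η r z).2 - J) d =
      maskOp (G.pattern (G.preProj η r (G.innerStep η r z).1))
        (G.stepOp η ((matOp z.2 - J) d)) := by
    rw [_root_.sub_apply, G.matOp_innerStep_snd]
    nth_rewrite 1 [hJ]
    rw [hG.sens_apply (abs_pattern_le_one _), ← hJ, ← map_sub, _root_.sub_apply]
    congr 1
    rw [map_sub]
    abel
  rw [e, mul_assoc]
  refine (hG.norm_maskOp_stepOp_le (abs_pattern_le_one _) _).trans ?_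
  exact mul_le_mul_of_nonneg_left (ContinuousLinearMap.le_opNorm _ _) hG.nonneg

theorem tendsto_inner_fst (r : Vec n) (z : Vec n × Matrix (Fin n) (Fin n) ℝ) :
    Tendsto (fun l => (G.inner η r z l).1) atTop (𝓝 (G.nashEq r)) := by
  rw [tendsto_iff_norm_sub_tendsto_zero]
  refine squeeze_zero (fun _ => norm_nonneg _) (hG.norm_inner_sub_nashEq_le r z) ?_
  simpa using (tendsto_pow_atTop_nhds_zero_of_lt_one hG.nonneg hG.lt_one).mul_const
    ‖z.1 - G.nashEq r‖

theorem tendsto_preProj_inner_fst (r : Vec n) (z : Vec n × Matrix (Fin n) (Fin n) ℝ) :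
    Tendsto (fun l => G.preProj η r (G.inner η r z l).1) atTop (𝓝 (G.nashPre η r)) := by
  have hc : Continuous fun ξ => G.preProj η r ξ := by
    simp only [preProj_eq]
    fun_prop
  exact (hc.tendsto _).comp (hG.tendsto_inner_fst r z)

/-- The patterns used are eventually admissible at the limit. They need not settle, but all share
the fixed point `J`, so every late pass contracts towards it. -/
theorem tendsto_matOp_inner_snd {r : Vec n} {J : Vec n →L[ℝ] Vec n}
    (hJ : ∀ χ ∈ G.admissible (G.nashPre η r), J = G.sens η χ)
    (z : Vec n × Matrix (Fin n) (Fin n) ℝ) :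
    Tendsto (fun l => matOp (G.inner η r z l).2) atTop (𝓝 J) := by
  rw [tendsto_iff_norm_sub_tendsto_zero]
  refine tendsto_zero_of_eventually_le_mul (fun _ => norm_nonneg _) hG.nonneg hG.lt_one ?_
  have h1 := (hG.tendsto_preProj_inner_fst r z).comp (tendsto_add_atTop_nat 1)
  filter_upwards [h1.eventually (G.eventually_admissible_subset (G.nashPre η r))] with l hl
  have h2 := hJ _ (hl (G.pattern_mem_admissible _))
  simp only [Function.comp, G.inner_succ] at h2
  rw [G.inner_succ]
  exact hG.norm_innerStep_sub_sens_le r _ h2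

theorem fderiv_nashEq_eq_sens {r : Vec n} (hr : DifferentiableAt ℝ G.nashEq r)
    {χ : Fin n → ℝ} (hχ : χ ∈ G.admissible (G.nashPre η r)) :
    fderiv ℝ G.nashEq r = G.sens η χ := by
  have := hG.hasFDerivAt_nashEq_comp (hasFDerivAt_id r) hr.hasFDerivAt hχ
  rw [this]
  ext; simp

theorem tendsto_matOp_inner_snd_fderiv {r : Vec n} (hr : DifferentiableAt ℝ G.nashEq r)
    (z : Vec n × Matrix (Fin n) (Fin n) ℝ) :
    Tendsto (fun l => matOp (G.inner η r z l).2) atTop (𝓝 (fderiv ℝ G.nashEq r)) :=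
  hG.tendsto_matOp_inner_snd (fun _ hχ => hG.fderiv_nashEq_eq_sens hr hχ) z

theorem tendsto_inner_snd {r : Vec n} (hr : DifferentiableAt ℝ G.nashEq r)
    (z : Vec n × Matrix (Fin n) (Fin n) ℝ) :
    Tendsto (fun l => (G.inner η r z l).2) atTop (𝓝 (jacobian G.nashEq r)) := by
  refine tendsto_pi_nhds.mpr fun i => tendsto_pi_nhds.mpr fun j => ?_
  have hc : Continuous fun A : Vec n →L[ℝ] Vec n => A (EuclideanSpace.single j 1) i := by
    fun_prop
  have h := (hc.tendsto _).comp (hG.tendsto_matOp_inner_snd_fderiv hr z)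
  refine h.congr fun l => ?_
  simp [matOp_apply]

theorem exists_innerReturns {r : Vec n} (hr : DifferentiableAt ℝ G.nashEq r)
    (z : Vec n × Matrix (Fin n) (Fin n) ℝ) {σ : ℝ} (hσ : 0 < σ) :
    ∃ z', G.InnerReturns η r z σ z' := by
  classical
  have h1 : Tendsto (fun l => ‖(G.inner η r z (l + 1)).1 - (G.inner η r z l).1‖) atTop (𝓝 0) := by
    have h := hG.tendsto_inner_fst r z
    simpa using ((h.comp (tendsto_add_atTop_nat 1)).sub h).norm
  have h2 : Tendsto (fun l => specNorm ((G.inner η r z (l + 1)).2 - (G.inner η r z l).2))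
      atTop (𝓝 0) := by
    have h := hG.tendsto_matOp_inner_snd_fderiv hr z
    have h3 := ((h.comp (tendsto_add_atTop_nat 1)).sub h).norm
    rw [sub_self, norm_zero] at h3
    refine h3.congr fun l => ?_
    rw [specNorm_eq_norm_matOp, matOp_sub]
    rfl
  have hex : ∃ l, G.InnerStop η r z σ l := by
    have := ((h1.eventually_lt_const hσ).and (h2.eventually_lt_const hσ)).exists
    obtain ⟨l, hl1, hl2⟩ := this
    exact ⟨l, max_le hl1.le hl2.le⟩
  exact ⟨_, Nat.find hex, Nat.find_spec hex, fun m hm => Nat.find_min hex hm, rfl⟩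

/-- The estimates returned by the inner loop are as accurate as the tolerance. -/
theorem innerReturns_approx {r : Vec n} {z z' : Vec n × Matrix (Fin n) (Fin n) ℝ} {σ : ℝ}
    (h : G.InnerReturns η r z σ z') :
    ‖z'.1 - G.nashEq r‖ ≤ σ / (1 - θ) ∧ ‖G.preProj η r z'.1 - G.nashPre η r‖ ≤ σ / (1 - θ) ∧
      ‖matOp z'.2 - G.sens η (G.pattern (G.preProj η r z'.1))‖ ≤ σ / (1 - θ) := by
  obtain ⟨l, hexit, -, rfl⟩ := h
  have hθ : 0 < 1 - θ := by linarith [hG.lt_one]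
  -- A posteriori bound: `b` and `a` are the errors before and after the last pass, which moved by
  -- at most `σ`.
  have key : ∀ a b : ℝ, 0 ≤ b → a ≤ θ * b → b ≤ σ + a → a ≤ σ / (1 - θ) := by
    intro a b hb h1 h2
    rw [le_div_iff₀ hθ]
    have h3 : b * (1 - θ) ≤ σ := by linarith
    have h4 : a ≤ b := h1.trans (mul_le_of_le_one_left hb hG.lt_one.le)
    exact (mul_le_mul_of_nonneg_right h4 hθ.le).trans h3
  have hs1 := (le_max_left _ _).trans hexit
  have hs2 := (le_max_right _ _).trans hexit
  rw [G.inner_succ] at hs1 hs2 ⊢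
  set w := G.inner η r z l
  have h1 : ‖(G.innerStep η r w).1 - G.nashEq r‖ ≤ σ / (1 - θ) := by
    refine key _ ‖w.1 - G.nashEq r‖ (norm_nonneg _) ?_ ?_
    · rw [innerStep_fst]
      nth_rewrite 1 [← hG.h_nashEq r]
      simpa using hG.norm_h_sub_le r r w.1 (G.nashEq r)
    · rw [norm_sub_rev] at hs1
      have := norm_sub_le_norm_sub_add_norm_sub w.1 (G.innerStep η r w).1 (G.nashEq r)
      linarith
  refine ⟨h1, ?_, ?_⟩
  · have h2 := hG.norm_preProj_sub_le r r (G.innerStep η r w).1 (G.nashEq r)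
    rw [sub_self, norm_zero, mul_zero, add_zero] at h2
    refine h2.trans (le_trans ?_ h1)
    exact mul_le_of_le_one_left (norm_nonneg _) hG.lt_one.le
  · refine key _ _ (norm_nonneg _) (hG.norm_innerStep_sub_sens_le r w rfl) ?_
    rw [specNorm_eq_norm_matOp, matOp_sub, norm_sub_rev] at hs2
    have := norm_sub_le_norm_sub_add_norm_sub (matOp w.2) (matOp (G.innerStep η r w).2)
      (G.sens η (G.pattern (G.preProj η r (G.innerStep η r w).1)))
    exact this.trans (add_le_add_left hs2 _)

theorem innerReturns_inBox {r : Vec n} {z z' : Vec n × Matrix (Fin n) (Fin n) ℝ} {σ : ℝ}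
    (h : G.InnerReturns η r z σ z') : G.InBox z'.1 := by
  obtain ⟨l, -, -, rfl⟩ := h
  rw [G.inner_succ]
  exact G.inBox_h hG.box _ _

theorem norm_matOp_innerStep_le (r : Vec n) (z : Vec n × Matrix (Fin n) (Fin n) ℝ) (d : Vec n) :
    ‖matOp (G.innerStep η r z).2 d‖ ≤ θ * ‖matOp z.2 d‖ + η * G.γ * ‖d‖ := by
  rw [G.matOp_innerStep_snd]
  refine (norm_maskOp_apply_le (abs_pattern_le_one _) _).trans ((norm_sub_le _ _).trans ?_)
  rw [norm_smul, Real.norm_of_nonneg hG.ηγ_pos.le]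
  exact add_le_add_left (hG.norm_stepOp_le _) _

/-- Such an `S` satisfies `θ S + η γ ≤ S`, so the bound is invariant under a pass, whatever the
pattern. -/
theorem innerReturns_norm_le {r : Vec n} {z z' : Vec n × Matrix (Fin n) (Fin n) ℝ} {σ S : ℝ}
    (h : G.InnerReturns η r z σ z') (hS : η * G.γ / (1 - θ) ≤ S)
    (hz : ∀ d, ‖matOp z.2 d‖ ≤ S * ‖d‖) (d : Vec n) : ‖matOp z'.2 d‖ ≤ S * ‖d‖ := by
  obtain ⟨l, -, -, rfl⟩ := h
  have hθ : 0 < 1 - θ := by linarith [hG.lt_one]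
  rw [div_le_iff₀ hθ] at hS
  induction l + 1 with
  | zero => exact hz d
  | succ m ih =>
    rw [G.inner_succ]
    have h1 := hG.norm_matOp_innerStep_le r (G.inner η r z m) d
    have h2 := mul_le_mul_of_nonneg_left ih hG.nonneg
    have h3 := mul_le_mul_of_nonneg_right hS (norm_nonneg d)
    linarith

/-- Coordinates of the reference beyond a threshold force the projection to be active. -/
theorem exists_threshold : ∃ K₀ : ℝ, 0 ≤ K₀ ∧ ∀ (r ξ : Vec n) (i : Fin n), G.InBox ξ →
    (K₀ < r i → G.preProj η r ξ i < G.qlo i) ∧ (r i < -K₀ → G.qhi i < G.preProj η r ξ i) := by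
  have hB : 0 ≤ G.boxBound := norm_nonneg _
  have hpos := hG.ηγ_pos
  -- The shift `η γ rᵢ` has to beat the linear part (one `boxBound`), the box limit (another) and
  -- the offset.
  refine ⟨(2 * G.boxBound + η * ‖G.offset‖) / (η * G.γ), div_nonneg (by
    have := mul_nonneg hG.η_pos.le (norm_nonneg G.offset)
    linarith) hpos.le, fun r ξ i hξ => ?_⟩
  have h1 : |G.stepOp η ξ i| ≤ G.boxBound := by
    refine (abs_apply_le_norm _ _).trans ((hG.norm_stepOp_le ξ).trans ?_)
    exact (mul_le_of_le_one_left (norm_nonneg _) hG.lt_one.le).trans hξ.norm_le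
  have h2 : |η * G.offset i| ≤ η * ‖G.offset‖ := by
    rw [abs_mul, abs_of_pos hG.η_pos]
    exact mul_le_mul_of_nonneg_left (abs_apply_le_norm _ _) hG.η_pos.le
  have h3 := G.abs_le_boxBound i
  have e : G.preProj η r ξ i = G.stepOp η ξ i - η * G.γ * r i + η * G.offset i := by
    simp [preProj_eq]
  rw [e]
  rw [abs_le] at h1 h2
  have h4 := abs_le.mp h3.1
  have h5 := abs_le.mp h3.2
  constructor
  · intro h
    rw [div_lt_iff₀ hpos] at h
    linarith
  · intro h
    rw [lt_neg, div_lt_iff₀ hpos] at h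
    linarith

/-- If the projection is active at coordinate `i` on the whole box, then the inner loop returns a
sensitivity matrix with zero row `i`, and contracts its column `i`. -/
theorem innerReturns_inactive {r : Vec n} {z z' : Vec n × Matrix (Fin n) (Fin n) ℝ} {σ : ℝ}
    {i : Fin n} (h : G.InnerReturns η r z σ z')
    (hi : ∀ ξ, G.InBox ξ → G.pattern (G.preProj η r ξ) i = 0) :
    (∀ d, matOp z'.2 d i = 0) ∧
      ‖matOp z'.2 (EuclideanSpace.single i 1)‖ ≤ θ * ‖matOp z.2 (EuclideanSpace.single i 1)‖ := by
  obtain ⟨l, -, -, rfl⟩ := h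
  have hp : ∀ w, G.pattern (G.preProj η r (G.innerStep η r w).1) i = 0 := fun w =>
    hi _ (G.inBox_h hG.box _ _)
  have hstep : ∀ w, ‖matOp (G.innerStep η r w).2 (EuclideanSpace.single i 1)‖ ≤
      θ * ‖matOp w.2 (EuclideanSpace.single i 1)‖ := by
    intro w
    rw [G.matOp_innerStep_snd, map_sub, map_smul]
    have : maskOp (G.pattern (G.preProj η r (G.innerStep η r w).1))
        (EuclideanSpace.single i 1) = 0 := by
      ext j
      rw [maskOp_apply]
      by_cases hj : j = i
      · subst hj
        simp [hp]
      · simp [hj]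
    rw [this, smul_zero, sub_zero]
    exact hG.norm_maskOp_stepOp_le (abs_pattern_le_one _) _
  constructor
  · intro d
    rw [G.inner_succ, G.matOp_innerStep_snd, maskOp_apply, hp, zero_mul]
  · induction l with
    | zero =>
      rw [G.inner_succ]
      exact hstep _
    | succ m ih =>
      rw [G.inner_succ]
      refine (hstep _).trans (le_trans ?_ ih)
      exact mul_le_of_le_one_left (norm_nonneg _) hG.lt_one.le

/-- The start has to lie in the box because the loop may stop after one pass, whose output is the
projection evaluated at the start itself. -/
theorem innerReturns_fst_apply {r : Vec n} {z z' : Vec n × Matrix (Fin n) (Fin n) ℝ} {σ : ℝ}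
    {i : Fin n} (h : G.InnerReturns η r z σ z') (hz : G.InBox z.1) :
    ((∀ ξ, G.InBox ξ → G.preProj η r ξ i < G.qlo i) → z'.1 i = G.qlo i) ∧
      ((∀ ξ, G.InBox ξ → G.qhi i < G.preProj η r ξ i) → z'.1 i = G.qhi i) := by
  obtain ⟨l, -, -, rfl⟩ := h
  have hb : G.InBox (G.inner η r z l).1 := by
    cases l with
    | zero => exact hz
    | succ m =>
      rw [G.inner_succ]
      exact G.inBox_h hG.box _ _
  have hbox := (hG.box i).le
  rw [G.inner_succ, innerStep_fst, h_eq_boxProj, boxProj_apply]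
  constructor
  · intro hlo
    have := (hlo _ hb).le
    rw [min_eq_right (this.trans hbox), max_eq_left this]
  · intro hhi
    rw [min_eq_left (hhi _ hb).le, max_eq_right hbox]

end IsContractive

end GridGame

/-! ### The relaxed objective: hypergradient, chain rule, gradients of smooth pieces -/

theorem hasDerivAt_max_zero_sq (x : ℝ) :
    HasDerivAt (fun y : ℝ => max 0 y ^ 2) (2 * max 0 x) x := by
  rw [hasDerivAt_iff_isLittleO]
  refine Asymptotics.IsBigO.trans_isLittleO (g := fun y => (y - x) ^ 2) ?_
    (by simpa using Asymptotics.isLittleO_pow_sub_sub x one_lt_two)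
  refine Asymptotics.IsBigO.of_bound 1 (Eventually.of_forall fun y => ?_)
  rw [Real.norm_eq_abs, Real.norm_eq_abs, one_mul, abs_of_nonneg (sq_nonneg (y - x)), smul_eq_mul,
    abs_le]
  rcases le_total 0 x with hx | hx <;> rcases le_total 0 y with hy | hy <;>
    simp only [max_eq_right, max_eq_left, hx, hy] <;> constructor <;> nlinarith

theorem contDiff_max_zero_sq : ContDiff ℝ 1 (fun y : ℝ => max 0 y ^ 2) := by
  rw [contDiff_one_iff_deriv]
  refine ⟨fun x => (hasDerivAt_max_zero_sq x).differentiableAt, ?_⟩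
  have : deriv (fun y : ℝ => max 0 y ^ 2) = fun x => 2 * max 0 x :=
    funext fun x => (hasDerivAt_max_zero_sq x).deriv
  rw [this]
  fun_prop

namespace GridGame

variable {n : ℕ} (G : GridGame n)

theorem voltage_eq (q : Vec n) :
    G.voltage q = matOp G.X q + WithLp.toLp 2 fun i => (G.R *ᵥ G.p) i + G.v₀ i := by
  ext i
  simp [voltage, matOp_apply]
  ring

theorem continuous_voltage : Continuous G.voltage := by
  have : G.voltage = fun q => matOp G.X q + WithLp.toLp 2 fun i => (G.R *ᵥ G.p) i + G.v₀ i :=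
    funext G.voltage_eq
  rw [this]
  fun_prop

theorem continuous_gradPenalty : Continuous G.gradPenalty := by
  unfold gradPenalty
  fun_prop

/-- The partial gradient of the objective `φ(vref, v(q), q)` in `q`. -/
noncomputable def adj (r q : Vec n) : Vec n :=
  G.γ • (G.voltage q - r) + matOp G.Xᵀ (G.γ • q + G.gradPenalty (G.voltage q))

theorem continuous_adj : Continuous fun p : Vec n × Vec n => G.adj p.1 p.2 := by
  have h1 := G.continuous_voltage
  have h2 := G.continuous_gradPenalty
  unfold adj
  fun_prop

/-- The hypergradient for the sensitivity operator `S`. -/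
noncomputable def hgrad (r q : Vec n) (S : Vec n →L[ℝ] Vec n) : Vec n :=
  -G.γ • q + ContinuousLinearMap.adjoint S (G.adj r q)

theorem continuous_hgrad :
    Continuous fun p : Vec n × Vec n × (Vec n →L[ℝ] Vec n) => G.hgrad p.1 p.2.1 p.2.2 := by
  have h1 : Continuous fun p : Vec n × Vec n × (Vec n →L[ℝ] Vec n) => G.adj p.1 p.2.1 :=
    Continuous.comp (g := fun p : Vec n × Vec n => G.adj p.1 p.2)
      (f := fun p : Vec n × Vec n × (Vec n →L[ℝ] Vec n) => (p.1, p.2.1)) G.continuous_adj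
      (by fun_prop)
  have h2 : Continuous fun S : Vec n →L[ℝ] Vec n => ContinuousLinearMap.adjoint S :=
    (ContinuousLinearMap.adjoint (𝕜 := ℝ) (E := Vec n) (F := Vec n)).continuous
  have h3 : Continuous fun p : Vec n × Vec n × (Vec n →L[ℝ] Vec n) =>
      ContinuousLinearMap.adjoint p.2.2 (G.adj p.1 p.2.1) :=
    (h2.comp (continuous_snd.comp continuous_snd)).clm_apply h1
  have h4 : Continuous fun p : Vec n × Vec n × (Vec n →L[ℝ] Vec n) => -G.γ • p.2.1 := by fun_prop
  exact h4.add h3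

theorem inner_hgrad (r q d : Vec n) (S : Vec n →L[ℝ] Vec n) :
    ⟪G.hgrad r q S, d⟫ = -G.γ * ⟪q, d⟫ + ⟪G.adj r q, S d⟫ := by
  rw [hgrad, inner_add_left, real_inner_smul_left, ContinuousLinearMap.adjoint_inner_left]

theorem inner_matOp_transpose (A : Matrix (Fin n) (Fin n) ℝ) (x y : Vec n) :
    ⟪matOp Aᵀ x, y⟫ = ⟪x, matOp A y⟫ := by
  rw [real_inner_comm, Matrix.inner_toEuclideanCLM, Matrix.inner_toEuclideanCLM,
    Matrix.mulVec_transpose, dotProduct_comm, Matrix.dotProduct_mulVec]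

theorem adjoint_matOp (A : Matrix (Fin n) (Fin n) ℝ) :
    ContinuousLinearMap.adjoint (matOp A) = matOp Aᵀ := by
  symm
  rw [ContinuousLinearMap.eq_adjoint_iff]
  exact inner_matOp_transpose A

theorem hypergrad_eq_hgrad (r ξ : Vec n) (s : Matrix (Fin n) (Fin n) ℝ) :
    G.hypergrad r ξ s = G.hgrad r ξ (matOp s) := by
  rw [hgrad, adj, adjoint_matOp, map_add, ← matOp_mul_apply, ← Matrix.transpose_mul]
  ext i
  simp only [hypergrad, PiLp.add_apply, PiLp.smul_apply, matOp_apply, smul_eq_mul]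
  have e1 : (G.γ • ξ + G.gradPenalty (G.voltage ξ)).ofLp =
      fun j => G.γ * ξ j + G.gradPenalty (G.voltage ξ) j := by
    ext j; simp
  have e2 : (G.γ • (G.voltage ξ - r)).ofLp = fun j => G.γ * (G.voltage ξ j - r j) := by
    ext j; simp
  rw [e1, e2]
  ring

/-- The objective as a function of the reference and the play. -/
noncomputable def playObjective (r q : Vec n) : ℝ := G.objective r (G.voltage q) q

theorem phiE_eq (r : Vec n) : G.phiE r = G.playObjective r (G.nashEq r) := rfl

theorem hasDerivAt_playObjective {x q : ℝ → Vec n} {x' q' : Vec n} {t : ℝ}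
    (hx : HasDerivAt x x' t) (hq : HasDerivAt q q' t) :
    HasDerivAt (fun a => G.playObjective (x a) (q a))
      (-G.γ * ⟪q t, x'⟫ + ⟪G.adj (x t) (q t), q'⟫) t := by
  have hxi : ∀ i, HasDerivAt (fun a => x a i) (x' i) t := fun i =>
    (EuclideanSpace.proj (𝕜 := ℝ) i).hasFDerivAt.comp_hasDerivAt t hx
  have hqi : ∀ i, HasDerivAt (fun a => q a i) (q' i) t := fun i =>
    (EuclideanSpace.proj (𝕜 := ℝ) i).hasFDerivAt.comp_hasDerivAt t hq
  have hvi : ∀ i, HasDerivAt (fun a => G.voltage (q a) i) (matOp G.X q' i) t := by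
    intro i
    have h1 : HasDerivAt (fun a => matOp G.X (q a)) (matOp G.X q') t :=
      (matOp G.X).hasFDerivAt.comp_hasDerivAt t hq
    have h2 := (EuclideanSpace.proj (𝕜 := ℝ) i).hasFDerivAt.comp_hasDerivAt t
      (h1.add_const (WithLp.toLp 2 fun i => (G.R *ᵥ G.p) i + G.v₀ i))
    simp only [G.voltage_eq]
    exact h2
  have hpos : ∀ {f : ℝ → ℝ} {f' : ℝ}, HasDerivAt f f' t →
      HasDerivAt (fun a => max 0 (f a) ^ 2) (2 * max 0 (f t) * f') t := fun hf =>
    (hasDerivAt_max_zero_sq _).comp t hf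
  have h1 : HasDerivAt (fun a => ∑ i, G.incentive (q a i) (G.voltage (q a) i) (x a i))
      (∑ i, (G.γ * (matOp G.X q' i - x' i) * q t i +
        G.γ * (G.voltage (q t) i - x t i) * q' i)) t :=
    HasDerivAt.fun_sum fun i _ => (((hvi i).sub (hxi i)).const_mul G.γ).mul (hqi i)
  have h2 : HasDerivAt (fun a => G.penalty (G.voltage (q a)))
      (∑ i, (G.ρ * (2 * max 0 (G.voltage (q t) i - G.vhi i) * matOp G.X q' i) +
        G.ρ * (2 * max 0 (G.vlo i - G.voltage (q t) i) * -matOp G.X q' i))) t :=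
    HasDerivAt.fun_sum fun i _ => ((hpos ((hvi i).sub_const _)).const_mul G.ρ).add
      ((hpos ((hvi i).const_sub _)).const_mul G.ρ)
  refine (h1.add h2).congr_deriv ?_
  rw [adj, inner_add_left, inner_matOp_transpose]
  simp only [PiLp.inner_apply, RCLike.inner_apply, conj_trivial, PiLp.add_apply, PiLp.smul_apply,
    PiLp.sub_apply, smul_eq_mul, gradPenalty]
  rw [Finset.mul_sum, ← Finset.sum_add_distrib, ← Finset.sum_add_distrib,
    ← Finset.sum_add_distrib]
  exact Finset.sum_congr rfl fun i _ => by ring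

theorem contDiff_playObjective :
    ContDiff ℝ 1 fun p : Vec n × Vec n => G.playObjective p.1 p.2 := by
  have hx : ∀ i, ContDiff ℝ 1 fun p : Vec n × Vec n => p.1 i := fun i =>
    (EuclideanSpace.proj (𝕜 := ℝ) i).contDiff.comp contDiff_fst
  have hq : ∀ i, ContDiff ℝ 1 fun p : Vec n × Vec n => p.2 i := fun i =>
    (EuclideanSpace.proj (𝕜 := ℝ) i).contDiff.comp contDiff_snd
  have hv : ∀ i, ContDiff ℝ 1 fun p : Vec n × Vec n => G.voltage p.2 i := by
    intro i
    simp only [G.voltage_eq]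
    exact (EuclideanSpace.proj (𝕜 := ℝ) i).contDiff.comp
      (((matOp G.X).contDiff.comp contDiff_snd).add contDiff_const)
  unfold playObjective objective penalty incentive
  refine ContDiff.add (ContDiff.sum fun i _ => ?_) (ContDiff.sum fun i _ => ?_)
  · exact (contDiff_const.mul ((hv i).sub (hx i))).mul (hq i)
  · exact (contDiff_const.mul (contDiff_max_zero_sq.comp ((hv i).sub contDiff_const))).add
      (contDiff_const.mul (contDiff_max_zero_sq.comp (contDiff_const.sub (hv i))))

variable {G} {η θ : ℝ}

namespace IsContractive

variable (hG : G.IsContractive η θ)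
include hG

theorem locallyLipschitz_phiE : LocallyLipschitz G.phiE := by
  have h1 := G.contDiff_playObjective.locallyLipschitz
  have h2 : LocallyLipschitz fun r : Vec n => (r, G.nashEq r) :=
    LocallyLipschitz.id.prodMk hG.lipschitzWith_nashEq.locallyLipschitz
  have h3 : G.phiE = (fun p : Vec n × Vec n => G.playObjective p.1 p.2) ∘ fun r => (r, G.nashEq r) :=
    funext fun r => rfl
  rw [h3]
  exact LocallyLipschitz.comp h1 h2

theorem continuous_phiE : Continuous G.phiE := hG.locallyLipschitz_phiE.continuous

variable (G η) in
/-- The gradient at `w` of the smooth piece of the relaxed objective with pattern `χ`. -/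
noncomputable def _root_.GridGame.pieceGrad (w : Vec n) (χ : Fin n → ℝ) : Vec n :=
  G.hgrad w (G.nashEq w) (G.sens η χ)

variable (G η) in
/-- The gradients of the smooth pieces active at `w`. -/
def _root_.GridGame.pieceGrads (w : Vec n) : Set (Vec n) :=
  G.pieceGrad η w '' G.admissible (G.nashPre η w)

omit hG in
theorem finite_pieceGrads (w : Vec n) : (G.pieceGrads η w).Finite :=
  (G.finite_admissible _).image _

/-- The nonsmooth chain rule behind the descent argument: once the equilibrium is differentiable
along the curve, every admissible pattern yields its derivative, so the choice of active piece is
immaterial. -/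
theorem hasDerivAt_phiE_comp {x : ℝ → Vec n} {x' : Vec n} {t : ℝ} (hx : HasDerivAt x x' t)
    (hq : DifferentiableAt ℝ (fun a => G.nashEq (x a)) t) {g : Vec n}
    (hg : g ∈ G.pieceGrads η (x t)) : HasDerivAt (fun a => G.phiE (x a)) ⟪g, x'⟫ t := by
  obtain ⟨χ, hχ, rfl⟩ := hg
  have h1 := hG.hasFDerivAt_nashEq_comp hx.hasFDerivAt hq.hasFDerivAt hχ
  have h2 := hq.hasFDerivAt
  rw [h1] at h2
  have h3 := h2.hasDerivAt
  refine (G.hasDerivAt_playObjective hx h3).congr_deriv ?_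
  rw [pieceGrad, inner_hgrad]
  simp

theorem gradient_phiE {u : Vec n} (hu : DifferentiableAt ℝ G.nashEq u) {g : Vec n}
    (hg : g ∈ G.pieceGrads η u) : DifferentiableAt ℝ G.phiE u ∧ gradient G.phiE u = g := by
  have hd : DifferentiableAt ℝ G.phiE u := by
    have h1 := (G.contDiff_playObjective.differentiable one_ne_zero) (u, G.nashEq u)
    exact DifferentiableAt.comp u (f := fun r => (r, G.nashEq r)) h1
      (differentiableAt_id.prodMk hu)
  refine ⟨hd, ?_⟩
  refine ext_inner_right ℝ fun d => ?_
  rw [gradient, InnerProductSpace.toDual_symm_apply]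
  have hline : HasDerivAt (fun t : ℝ => u + t • d) d 0 := by
    simpa using ((hasDerivAt_id (0 : ℝ)).smul_const d).const_add u
  have h0 : u + (0 : ℝ) • d = u := by simp
  have h1 : DifferentiableAt ℝ (fun t : ℝ => G.nashEq (u + t • d)) 0 :=
    DifferentiableAt.comp (0 : ℝ) (g := G.nashEq) (f := fun t : ℝ => u + t • d) (by rwa [h0])
      hline.differentiableAt
  have h2 := hG.hasDerivAt_phiE_comp hline h1 (g := g) (by simpa using hg)
  have h3 := (show HasFDerivAt G.phiE (fderiv ℝ G.phiE u) (u + (0 : ℝ) • d) by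
    rw [h0]; exact hd.hasFDerivAt).comp_hasDerivAt (0 : ℝ) hline
  exact h3.unique h2

/-- The gradients of active pieces are limits of gradients at nearby points. -/
theorem exists_seq_gradient_tendsto {w g : Vec n} (hg : g ∈ G.pieceGrads η w) :
    ∃ u : ℕ → Vec n, Tendsto u atTop (𝓝 w) ∧ (∀ m, DifferentiableAt ℝ G.phiE (u m)) ∧
      Tendsto (fun m => gradient G.phiE (u m)) atTop (𝓝 g) := by
  obtain ⟨χ, hχ, rfl⟩ := hg
  -- Free coordinates move towards the midpoint of their interval, saturated ones away from it.
  -- Short moves along `d` then land in the open region with pattern `χ`, and `refOfPre` pulls them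
  -- back to references.
  have hdir : ∃ d : Vec n, ∀ t : ℝ, 0 < t → t ≤ 1 → ∀ i,
      (χ i = 1 ∧ G.qlo i < (G.nashPre η w + t • d) i ∧ (G.nashPre η w + t • d) i < G.qhi i) ∨
      (χ i = 0 ∧ ((G.nashPre η w + t • d) i < G.qlo i ∨ G.qhi i < (G.nashPre η w + t • d) i)) := by
    have : ∀ i, ∃ d : ℝ, ∀ t : ℝ, 0 < t → t ≤ 1 →
      (χ i = 1 ∧ G.qlo i < G.nashPre η w i + t * d ∧ G.nashPre η w i + t * d < G.qhi i) ∨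
      (χ i = 0 ∧ (G.nashPre η w i + t * d < G.qlo i ∨ G.qhi i < G.nashPre η w i + t * d)) := by
      intro i
      have hb := hG.box i
      rcases hχ i with ⟨h, h1, h2⟩ | ⟨h, h1 | h1⟩
      · refine ⟨(G.qlo i + G.qhi i) / 2 - G.nashPre η w i, fun t ht ht1 => Or.inl ⟨h, ?_, ?_⟩⟩ <;>
          nlinarith
      · exact ⟨-1, fun t ht ht1 => Or.inr ⟨h, Or.inl (by linarith)⟩⟩
      · exact ⟨1, fun t ht ht1 => Or.inr ⟨h, Or.inr (by linarith)⟩⟩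
    choose d hd using this
    exact ⟨WithLp.toLp 2 d, fun t ht ht1 i => by simpa using hd i t ht ht1⟩
  obtain ⟨d, hd⟩ := hdir
  set y : ℕ → Vec n := fun m => G.nashPre η w + (1 / ((m : ℝ) + 1)) • d with hy
  have hty : Tendsto y atTop (𝓝 (G.nashPre η w)) := by
    have := (tendsto_one_div_add_atTop_nhds_zero_nat (𝕜 := ℝ)).smul_const d
    rw [zero_smul] at this
    simpa only [add_zero] using this.const_add (G.nashPre η w)
  have htu : Tendsto (fun m => G.refOfPre η (y m)) atTop (𝓝 w) := by
    have := ((G.continuous_refOfPre η).tendsto _).comp hty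
    rwa [hG.refOfPre_nashPre] at this
  have hstrict : ∀ m i,
      (χ i = 1 ∧ G.qlo i < G.nashPre η (G.refOfPre η (y m)) i ∧
        G.nashPre η (G.refOfPre η (y m)) i < G.qhi i) ∨
      (χ i = 0 ∧ (G.nashPre η (G.refOfPre η (y m)) i < G.qlo i ∨
        G.qhi i < G.nashPre η (G.refOfPre η (y m)) i)) := by
    intro m
    rw [hG.nashPre_refOfPre]
    have hm : (1 : ℝ) ≤ (m : ℝ) + 1 := by
      have : (0 : ℝ) ≤ m := Nat.cast_nonneg m
      linarith
    exact hd _ (by positivity) (by rw [div_le_one (by positivity)]; exact hm)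
  have hgrad : ∀ m, DifferentiableAt ℝ G.phiE (G.refOfPre η (y m)) ∧
      gradient G.phiE (G.refOfPre η (y m)) = G.pieceGrad η (G.refOfPre η (y m)) χ := by
    intro m
    refine hG.gradient_phiE (hG.hasFDerivAt_nashEq (hstrict m)).differentiableAt ⟨χ, ?_, rfl⟩
    intro i
    rcases hstrict m i with ⟨h, h1, h2⟩ | ⟨h, h1⟩
    · exact Or.inl ⟨h, h1.le, h2.le⟩
    · exact Or.inr ⟨h, h1.imp le_of_lt le_of_lt⟩
  refine ⟨_, htu, fun m => (hgrad m).1, ?_⟩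
  simp only [fun m => (hgrad m).2]
  have hc : Continuous fun r => G.pieceGrad η r χ :=
    G.continuous_hgrad.comp (continuous_id.prodMk (hG.continuous_nashEq.prodMk continuous_const))
  exact (hc.tendsto w).comp htu

theorem isCritical_of_zero_mem {w : Vec n} (h : (0 : Vec n) ∈ convexHull ℝ (G.pieceGrads η w)) :
    IsCritical G.phiE w :=
  convexHull_mono (fun _ hg => hG.exists_seq_gradient_tendsto hg) h

omit hG in
/-- Near `w` the gradients of the active pieces are close to those active at `w`. -/
theorem exists_hgrad_near (w : Vec n) {δ : ℝ} (hδ : 0 < δ) :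
    ∃ κ > 0, ∀ (r q y : Vec n) (S : Vec n →L[ℝ] Vec n), ‖r - w‖ < κ → ‖q - G.nashEq w‖ < κ →
      ‖y - G.nashPre η w‖ < κ → ∀ χ ∈ G.admissible y, ‖S - G.sens η χ‖ < κ →
        ∃ g ∈ G.pieceGrads η w, ‖G.hgrad r q S - g‖ < δ := by
  have h1 : ∀ᶠ κ in 𝓝[>] (0 : ℝ), ∀ y, ‖y - G.nashPre η w‖ < κ →
      G.admissible y ⊆ G.admissible (G.nashPre η w) := by
    obtain ⟨κ, hκ, h⟩ := Metric.eventually_nhds_iff.mp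
      (G.eventually_admissible_subset (G.nashPre η w))
    filter_upwards [Ioo_mem_nhdsGT hκ] with κ' hκ' y hy
    exact h (by rw [dist_eq_norm]; exact hy.trans hκ'.2)
  have h2 : ∀ᶠ κ in 𝓝[>] (0 : ℝ), ∀ χ ∈ G.admissible (G.nashPre η w),
      ∀ (r q : Vec n) (S : Vec n →L[ℝ] Vec n), ‖r - w‖ < κ → ‖q - G.nashEq w‖ < κ →
        ‖S - G.sens η χ‖ < κ → ‖G.hgrad r q S - G.pieceGrad η w χ‖ < δ := by
    rw [Filter.eventually_all_finite (G.finite_admissible _)]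
    intro χ _
    have hc := G.continuous_hgrad.continuousAt (x := (w, G.nashEq w, G.sens η χ))
    obtain ⟨κ, hκ, h⟩ := Metric.continuousAt_iff.mp hc δ hδ
    filter_upwards [Ioo_mem_nhdsGT hκ] with κ' hκ' r q S hr hq hS
    have := @h (r, q, S) (by
      simp only [dist_eq_norm]
      exact max_lt (hr.trans hκ'.2) (max_lt (hq.trans hκ'.2) (hS.trans hκ'.2)))
    rwa [dist_eq_norm] at this
  obtain ⟨κ, ⟨h3, h4⟩, h5⟩ := ((h1.and h2).and self_mem_nhdsWithin).exists
  exact ⟨κ, h5, fun r q y S hr hq hy χ hχ hS =>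
    ⟨_, ⟨_, h3 y hy hχ, rfl⟩, h4 _ (h3 y hy hχ) r q S hr hq hS⟩⟩

end IsContractive

end GridGame

/-! ### Finiteness of the set of critical values -/

theorem inner_eq_of_mem_convexHull {n : ℕ} {s : Set (Vec n)} {d v : Vec n} {c : ℝ}
    (h : ∀ g ∈ s, ⟪g, d⟫ = c) (hv : v ∈ convexHull ℝ s) : ⟪v, d⟫ = c := by
  have hlin : IsLinearMap ℝ fun g : Vec n => ⟪g, d⟫ :=
    ⟨fun x y => inner_add_left x y d, fun a x => real_inner_smul_left x d a⟩
  exact convexHull_min (t := {g : Vec n | ⟪g, d⟫ = c}) (fun g hg => h g hg)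
    (convex_hyperplane hlin c) hv

theorem le_inner_of_mem_convexHull {n : ℕ} {s : Set (Vec n)} {d v : Vec n} {c : ℝ}
    (h : ∀ g ∈ s, c ≤ ⟪g, d⟫) (hv : v ∈ convexHull ℝ s) : c ≤ ⟪v, d⟫ := by
  have hlin : IsLinearMap ℝ fun g : Vec n => ⟪g, d⟫ :=
    ⟨fun x y => inner_add_left x y d, fun a x => real_inner_smul_left x d a⟩
  exact convexHull_min (t := {g : Vec n | c ≤ ⟪g, d⟫}) (fun g hg => h g hg)
    (convex_halfSpace_ge hlin c) hv

theorem max_zero_sq_sub_eq {a b : ℝ} (hab : 0 < a ↔ 0 < b) :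
    max 0 b ^ 2 - max 0 a ^ 2 = (max 0 a + max 0 b) * (b - a) := by
  by_cases ha : 0 < a
  · rw [max_eq_right ha.le, max_eq_right (hab.mp ha).le]
    ring
  · rw [max_eq_left (not_lt.mp ha), max_eq_left (not_lt.mp fun hb => ha (hab.mpr hb))]
    ring

namespace GridGame

variable {n : ℕ} (G : GridGame n)

/-- The cell of the subdivision on which the relaxed objective is quadratic. -/
noncomputable def cell (η : ℝ) (w : Vec n) :
    Fin n → (Prop × Prop) × (Prop × Prop) × (Prop × Prop) := fun i =>
  ((G.nashPre η w i < G.qlo i, G.qlo i < G.nashPre η w i),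
    (G.nashPre η w i < G.qhi i, G.qhi i < G.nashPre η w i),
    (0 < G.voltage (G.nashEq w) i - G.vhi i, 0 < G.vlo i - G.voltage (G.nashEq w) i))

/-- The trapezoid rule is exact for quadratics, and the sign conditions say that each penalty term
stays on one quadratic branch. -/
theorem playObjective_trapezoid {r₁ r₂ q₁ q₂ : Vec n}
    (h1 : ∀ i, 0 < G.voltage q₁ i - G.vhi i ↔ 0 < G.voltage q₂ i - G.vhi i)
    (h2 : ∀ i, 0 < G.vlo i - G.voltage q₁ i ↔ 0 < G.vlo i - G.voltage q₂ i) :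
    2 * (G.playObjective r₂ q₂ - G.playObjective r₁ q₁) =
      (-G.γ * ⟪q₁, r₂ - r₁⟫ + ⟪G.adj r₁ q₁, q₂ - q₁⟫) +
        (-G.γ * ⟪q₂, r₂ - r₁⟫ + ⟪G.adj r₂ q₂, q₂ - q₁⟫) := by
  have hX : ∀ i, matOp G.X (q₂ - q₁) i = G.voltage q₂ i - G.voltage q₁ i := by
    intro i
    rw [voltage_eq, voltage_eq, map_sub]
    simp
  rw [adj, adj, inner_add_left, inner_add_left, inner_matOp_transpose, inner_matOp_transpose]
  simp only [PiLp.inner_apply, RCLike.inner_apply, conj_trivial, PiLp.add_apply, PiLp.smul_apply,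
    PiLp.sub_apply, smul_eq_mul, hX, playObjective, objective, penalty, incentive]
  rw [← Finset.sum_add_distrib, ← Finset.sum_add_distrib, ← Finset.sum_sub_distrib,
    Finset.mul_sum, Finset.mul_sum, Finset.mul_sum, ← Finset.sum_add_distrib,
    ← Finset.sum_add_distrib, ← Finset.sum_add_distrib, ← Finset.sum_add_distrib,
    ← Finset.sum_add_distrib]
  refine Finset.sum_congr rfl fun i _ => ?_
  have e1 := max_zero_sq_sub_eq (h1 i)
  have e2 := max_zero_sq_sub_eq (h2 i)
  simp only [gradPenalty]
  linear_combination 2 * G.ρ * e1 + 2 * G.ρ * e2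

variable {G} {η θ : ℝ}

namespace IsContractive

variable (hG : G.IsContractive η θ)
include hG

/-- Within a cell a coordinate on a kink stays on that kink, so its increment is zero before and
after the projection and either value of `χᵢ` is correct. -/
theorem nashEq_sub_eq_of_cell_eq {w₁ w₂ : Vec n} (h : G.cell η w₁ = G.cell η w₂)
    {χ : Fin n → ℝ} (hχ : χ ∈ G.admissible (G.nashPre η w₁)) :
    G.nashEq w₂ - G.nashEq w₁ = G.sens η χ (w₂ - w₁) := by
  refine hG.eq_sens_apply (G.abs_le_one_of_mem_admissible hχ) ?_
  have e : G.stepOp η (G.nashEq w₂ - G.nashEq w₁) - (η * G.γ) • (w₂ - w₁) =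
      G.nashPre η w₂ - G.nashPre η w₁ := by
    simp only [nashPre, preProj_eq, map_sub]
    module
  rw [e]
  ext i
  rw [maskOp_apply, PiLp.sub_apply, PiLp.sub_apply]
  have hproj : ∀ w, G.nashEq w i = max (G.qlo i) (min (G.qhi i) (G.nashPre η w i)) := by
    intro w
    nth_rewrite 1 [← hG.boxProj_nashPre w]
    rfl
  rw [hproj, hproj]
  have hi := congrFun h i
  simp only [cell, Prod.mk.injEq, eq_iff_iff] at hi
  obtain ⟨⟨ha, hb⟩, ⟨hc, hd⟩, -⟩ := hi
  have hbox := hG.box i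
  have hχi := hχ i
  generalize G.nashPre η w₁ i = y₁ at *
  generalize G.nashPre η w₂ i = y₂ at *
  rcases lt_trichotomy y₁ (G.qlo i) with h1 | h1 | h1
  · have h2 := ha.mp h1
    have : χ i = 0 := by
      rcases hχi with h3 | h3
      · exact absurd h1 (not_lt.mpr h3.2.1)
      · exact h3.1
    rw [this, min_eq_right (h1.le.trans hbox.le), min_eq_right (h2.le.trans hbox.le),
      max_eq_left h1.le, max_eq_left h2.le]
    ring
  · have h2 : y₂ = G.qlo i := by
      refine le_antisymm ?_ ?_
      · exact not_lt.mp fun h3 => absurd (hb.mpr h3) (by simp [h1])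
      · exact not_lt.mp fun h3 => absurd (ha.mpr h3) (by simp [h1])
    rw [h1, h2]
    ring
  · have h2 := hb.mp h1
    rcases lt_trichotomy y₁ (G.qhi i) with h3 | h3 | h3
    · have h4 := hc.mp h3
      have : χ i = 1 := by
        rcases hχi with h5 | ⟨-, h5 | h5⟩
        · exact h5.1
        · exact absurd h1 (not_lt.mpr h5)
        · exact absurd h3 (not_lt.mpr h5)
      rw [this, min_eq_right h3.le, min_eq_right h4.le, max_eq_right h1.le, max_eq_right h2.le]
      ring
    · have h4 : y₂ = G.qhi i := by
        refine le_antisymm ?_ ?_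
        · exact not_lt.mp fun h5 => absurd (hd.mpr h5) (by simp [h3])
        · exact not_lt.mp fun h5 => absurd (hc.mpr h5) (by simp [h3])
      rw [h3, h4]
      ring
    · have h4 := hd.mp h3
      have : χ i = 0 := by
        rcases hχi with h5 | h5
        · exact absurd h3 (not_lt.mpr h5.2.2)
        · exact h5.1
      rw [this, min_eq_left h3.le, min_eq_left h4.le]
      ring

/-- At each endpoint all active gradients have the same product with `w₂ - w₁`. As zero is in their
hull, that product is zero, and the trapezoid rule gives equal values. -/
theorem phiE_eq_of_cell_eq {w₁ w₂ : Vec n} (h : G.cell η w₁ = G.cell η w₂)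
    (h1 : (0 : Vec n) ∈ convexHull ℝ (G.pieceGrads η w₁))
    (h2 : (0 : Vec n) ∈ convexHull ℝ (G.pieceGrads η w₂)) : G.phiE w₁ = G.phiE w₂ := by
  have d1 := inner_eq_of_mem_convexHull (d := w₂ - w₁)
    (c := -G.γ * ⟪G.nashEq w₁, w₂ - w₁⟫ + ⟪G.adj w₁ (G.nashEq w₁), G.nashEq w₂ - G.nashEq w₁⟫)
    (by
      rintro _ ⟨χ, hχ, rfl⟩
      rw [pieceGrad, inner_hgrad, hG.nashEq_sub_eq_of_cell_eq h hχ]) h1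
  have d2 := inner_eq_of_mem_convexHull (d := w₂ - w₁)
    (c := -G.γ * ⟪G.nashEq w₂, w₂ - w₁⟫ + ⟪G.adj w₂ (G.nashEq w₂), G.nashEq w₂ - G.nashEq w₁⟫)
    (by
      rintro _ ⟨χ, hχ, rfl⟩
      have e := hG.nashEq_sub_eq_of_cell_eq h.symm hχ
      rw [← neg_sub w₂ w₁, map_neg] at e
      rw [pieceGrad, inner_hgrad, ← neg_sub (G.nashEq w₁), e, neg_neg]) h2
  rw [inner_zero_left] at d1 d2
  have hc := fun i => congrFun h i
  simp only [cell, Prod.mk.injEq, eq_iff_iff] at hc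
  have := G.playObjective_trapezoid (r₁ := w₁) (r₂ := w₂) (q₁ := G.nashEq w₁) (q₂ := G.nashEq w₂)
    (fun i => (hc i).2.2.1) (fun i => (hc i).2.2.2)
  rw [← d1, ← d2] at this
  rw [phiE_eq, phiE_eq]
  linarith

/-- The relaxed objective takes finitely many values at critical points. -/
theorem finite_critical_values :
    (G.phiE '' {w | (0 : Vec n) ∈ convexHull ℝ (G.pieceGrads η w)}).Finite := by
  classical
  let f : (Fin n → (Prop × Prop) × (Prop × Prop) × (Prop × Prop)) → ℝ := fun c =>
    G.phiE (Classical.epsilon fun w =>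
      (0 : Vec n) ∈ convexHull ℝ (G.pieceGrads η w) ∧ G.cell η w = c)
  refine (Set.finite_range f).subset ?_
  rintro _ ⟨w, hw, rfl⟩
  have := Classical.epsilon_spec (p := fun w' =>
      (0 : Vec n) ∈ convexHull ℝ (G.pieceGrads η w') ∧ G.cell η w' = G.cell η w) ⟨w, hw, rfl⟩
  exact ⟨G.cell η w, hG.phiE_eq_of_cell_eq this.2 this.1 hw⟩

end IsContractive

end GridGame

/-! ### Perturbed descent and its limit curves -/

/-- The sequence `r` makes steps of sizes `ε` along directions `-g` which asymptotically lie in the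
values of the set-valued map `V` at nearby points. -/
structure IsPerturbedDescent {n : ℕ} (V : Vec n → Set (Vec n)) (Γ : ℝ) (ε : ℕ → ℝ)
    (r g : ℕ → Vec n) : Prop where
  step : IsStepSeq ε
  update : ∀ k, r (k + 1) = r k - ε k • g k
  norm_le : ∀ k, ‖g k‖ ≤ Γ
  bounded : ∃ B, ∀ k, ‖r k‖ ≤ B
  approx : ∀ (w : Vec n) (δ : ℝ), 0 < δ → ∃ κ > 0, ∀ᶠ k in atTop, ‖r k - w‖ < κ →
    ∃ p ∈ V w, ‖g k - p‖ < δ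

namespace IsStepSeq

variable {ε : ℕ → ℝ}

/-- The time elapsed before step `k`. -/
noncomputable def _root_.elapsed (ε : ℕ → ℝ) (k : ℕ) : ℝ := ∑ i ∈ Finset.range k, ε i

variable (hε : IsStepSeq ε)
include hε

theorem monotone_elapsed : Monotone (elapsed ε) :=
  monotone_nat_of_le_succ fun k => by
    rw [elapsed, elapsed, Finset.sum_range_succ]
    linarith [hε.1 k]

theorem tendsto_elapsed : Tendsto (elapsed ε) atTop atTop :=
  (not_summable_iff_tendsto_nat_atTop_of_nonneg fun k => (hε.1 k).le).mp hε.2.2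

theorem exists_reach (k : ℕ) (t : ℝ) : ∃ m, k ≤ m ∧ elapsed ε k + t ≤ elapsed ε m :=
  ((eventually_ge_atTop k).and (hε.tendsto_elapsed.eventually_ge_atTop _)).exists

/-- The first step index from `k` on at which time `t` has elapsed since step `k`. -/
noncomputable def reach (k : ℕ) (t : ℝ) : ℕ := by
  classical exact Nat.find (hε.exists_reach k t)

theorem le_reach (k : ℕ) (t : ℝ) : k ≤ hε.reach k t := by
  classical exact (Nat.find_spec (hε.exists_reach k t)).1

theorem elapsed_add_le (k : ℕ) (t : ℝ) : elapsed ε k + t ≤ elapsed ε (hε.reach k t) := by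
  classical exact (Nat.find_spec (hε.exists_reach k t)).2

theorem elapsed_lt_of_lt_reach {k m : ℕ} {t : ℝ} (hkm : k ≤ m) (hm : m < hε.reach k t) :
    elapsed ε m < elapsed ε k + t := by
  classical
  have := Nat.find_min (hε.exists_reach k t) hm
  by_contra! hc
  exact this ⟨hkm, hc⟩

theorem lt_reach (k : ℕ) {t : ℝ} (ht : 0 < t) : k < hε.reach k t := by
  refine lt_of_le_of_ne (hε.le_reach k t) fun h => ?_
  have := hε.elapsed_add_le k t
  rw [← h] at this
  linarith

theorem reach_mono (k : ℕ) {t t' : ℝ} (h : t ≤ t') : hε.reach k t ≤ hε.reach k t' := by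
  classical
  refine Nat.find_min' _ ⟨hε.le_reach k t', ?_⟩
  linarith [hε.elapsed_add_le k t']

theorem tendsto_reach (t : ℝ) : Tendsto (fun k => hε.reach k t) atTop atTop :=
  tendsto_atTop_mono (fun k => hε.le_reach k t) tendsto_id

/-- The overshoot is less than the last step size, which tends to zero. For `t ≤ 0` no step is made,
whence `max t 0`. -/
theorem tendsto_elapsed_reach (t : ℝ) :
    Tendsto (fun k => elapsed ε (hε.reach k t) - elapsed ε k) atTop (𝓝 (max t 0)) := by
  have hlow : ∀ k, max t 0 ≤ elapsed ε (hε.reach k t) - elapsed ε k := by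
    intro k
    refine max_le ?_ ?_
    · linarith [hε.elapsed_add_le k t]
    · linarith [hε.monotone_elapsed (hε.le_reach k t)]
  rw [Metric.tendsto_atTop]
  intro δ hδ
  obtain ⟨K, hK⟩ := eventually_atTop.mp (hε.2.1.eventually_lt_const hδ)
  refine ⟨K, fun k hk => ?_⟩
  rw [Real.dist_eq, abs_of_nonneg (by linarith [hlow k])]
  rcases (hε.le_reach k t).eq_or_lt with h | h
  · rw [← h, sub_self]
    linarith [le_max_right t 0]
  · obtain ⟨m, hm⟩ : ∃ m, hε.reach k t = m + 1 := ⟨hε.reach k t - 1, by omega⟩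
    have h1 := hε.elapsed_lt_of_lt_reach (k := k) (m := m) (t := t) (by omega) (by omega)
    have h2 : elapsed ε (m + 1) = elapsed ε m + ε m := Finset.sum_range_succ _ _
    rw [hm, h2]
    linarith [hK m (by omega), le_max_left t 0]

end IsStepSeq

namespace IsPerturbedDescent

variable {n : ℕ} {V : Vec n → Set (Vec n)} {Γ : ℝ} {ε : ℕ → ℝ} {r g : ℕ → Vec n}
  (h : IsPerturbedDescent V Γ ε r g)
include h

theorem Γ_nonneg : 0 ≤ Γ := (norm_nonneg _).trans (h.norm_le 0)

theorem sub_eq_sum {k m : ℕ} (hkm : k ≤ m) : r k - r m = ∑ i ∈ Finset.Ico k m, ε i • g i := by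
  induction m, hkm using Nat.le_induction with
  | base => simp
  | succ m hkm ih =>
    rw [Finset.sum_Ico_succ_top hkm, ← ih, h.update]
    abel

theorem norm_sub_le_elapsed {k m : ℕ} (hkm : k ≤ m) :
    ‖r m - r k‖ ≤ Γ * (elapsed ε m - elapsed ε k) := by
  rw [norm_sub_rev, h.sub_eq_sum hkm, elapsed, elapsed, ← Finset.sum_Ico_eq_sub _ hkm,
    Finset.mul_sum]
  refine norm_sum_le_of_le _ fun i _ => ?_
  rw [norm_smul, Real.norm_of_nonneg (h.step.1 i).le, mul_comm]
  exact mul_le_mul_of_nonneg_right (h.norm_le i) (h.step.1 i).le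

theorem tendsto_succ_sub : Tendsto (fun k => r (k + 1) - r k) atTop (𝓝 0) := by
  have h1 : Tendsto (fun k => Γ * ε k) atTop (𝓝 0) := by simpa using h.step.2.1.const_mul Γ
  refine squeeze_zero_norm (fun k => ?_) h1
  have := h.norm_sub_le_elapsed (Nat.le_succ k)
  rw [elapsed, elapsed, Finset.sum_range_succ] at this
  simpa using this

theorem exists_ultrafilter_limit {F : Filter ℕ} [F.NeBot] :
    ∃ (𝒰 : Ultrafilter ℕ) (w : Vec n), (𝒰 : Filter ℕ) ≤ F ∧ Tendsto r 𝒰 (𝓝 w) := by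
  obtain ⟨B, hB⟩ := h.bounded
  obtain ⟨w, -, hw⟩ := (isCompact_closedBall (0 : Vec n) B).ultrafilter_le_nhds
    ((Ultrafilter.of F).map r) (by
      rw [le_principal_iff]
      exact Ultrafilter.mem_map.mpr (univ_mem' fun k => by simpa using hB k))
  exact ⟨Ultrafilter.of F, w, Ultrafilter.of_le F, hw⟩

/-- The limit along an ultrafilter of the trajectories started at late steps. -/
theorem exists_limit_curve {𝒰 : Ultrafilter ℕ} (h𝒰 : (𝒰 : Filter ℕ) ≤ atTop) {w : Vec n}
    (hw : Tendsto r 𝒰 (𝓝 w)) (hV : ∀ a, (V a).Finite) :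
    ∃ x : ℝ → Vec n, x 0 = w ∧ LipschitzWith (Real.toNNReal Γ) x ∧
      (∀ t, Tendsto (fun k => r (h.step.reach k t)) 𝒰 (𝓝 (x t))) ∧
      ∀ t, 0 < t → ∀ x', HasDerivAt x x' t → -x' ∈ convexHull ℝ (V (x t)) := by
  -- By boundedness one ultrafilter gives limits at all times `t` at once, so no subsequences are
  -- extracted.
  have hex : ∀ t, ∃ a, Tendsto (fun k => r (h.step.reach k t)) 𝒰 (𝓝 a) := by
    intro t
    obtain ⟨B, hB⟩ := h.bounded
    obtain ⟨a, -, ha⟩ := (isCompact_closedBall (0 : Vec n) B).ultrafilter_le_nhds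
      (𝒰.map fun k => r (h.step.reach k t)) (by
        rw [le_principal_iff]
        exact Ultrafilter.mem_map.mpr (univ_mem' fun k => by simpa using hB _))
    exact ⟨a, ha⟩
  choose x hx using hex
  have hmax : ∀ t t', t ≤ t' → ‖x t' - x t‖ ≤ Γ * (max t' 0 - max t 0) := by
    intro t t' htt
    have h1 : Tendsto (fun k => ‖r (h.step.reach k t') - r (h.step.reach k t)‖) 𝒰
        (𝓝 ‖x t' - x t‖) := ((hx t').sub (hx t)).norm
    have h2 : Tendsto (fun k => Γ * ((elapsed ε (h.step.reach k t') - elapsed ε k) -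
        (elapsed ε (h.step.reach k t) - elapsed ε k))) 𝒰 (𝓝 (Γ * (max t' 0 - max t 0))) :=
      (((h.step.tendsto_elapsed_reach t').mono_left h𝒰).sub
        ((h.step.tendsto_elapsed_reach t).mono_left h𝒰)).const_mul Γ
    refine le_of_tendsto_of_tendsto' h1 h2 fun k => ?_
    rw [sub_sub_sub_cancel_right]
    exact h.norm_sub_le_elapsed (h.step.reach_mono k htt)
  refine ⟨x, ?_, ?_, hx, ?_⟩
  · have h1 : Tendsto (fun k => r (h.step.reach k 0) - r k) 𝒰 (𝓝 0) := by
      have h2 : Tendsto (fun k => Γ * (elapsed ε (h.step.reach k 0) - elapsed ε k)) 𝒰 (𝓝 0) := by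
        simpa using ((h.step.tendsto_elapsed_reach 0).mono_left h𝒰).const_mul Γ
      exact squeeze_zero_norm (fun k => h.norm_sub_le_elapsed (h.step.le_reach k 0)) h2
    have h3 := ((hx 0).sub hw)
    exact sub_eq_zero.mp (tendsto_nhds_unique h3 h1)
  · refine LipschitzWith.of_dist_le_mul fun t t' => ?_
    rw [Real.coe_toNNReal _ h.Γ_nonneg, dist_eq_norm, Real.dist_eq]
    have hm : ∀ a b : ℝ, a ≤ b → max b 0 - max a 0 ≤ b - a := by
      intro a b hab
      rcases le_total a 0 with ha | ha <;> rcases le_total b 0 with hb | hb <;>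
        simp only [max_eq_left, max_eq_right, ha, hb] <;> linarith
    rcases le_total t t' with htt | htt
    · rw [norm_sub_rev, abs_sub_comm, abs_of_nonneg (sub_nonneg.mpr htt)]
      exact (hmax t t' htt).trans (mul_le_mul_of_nonneg_left (hm _ _ htt) h.Γ_nonneg)
    · rw [abs_of_nonneg (sub_nonneg.mpr htt)]
      exact (hmax t' t htt).trans (mul_le_mul_of_nonneg_left (hm _ _ htt) h.Γ_nonneg)
  · intro t ht x' hx'
    have hcl : IsClosed (convexHull ℝ (V (x t))) := (hV _).isClosed_convexHull ℝ
    rw [← hcl.closure_eq, Metric.closure_eq_iInter_cthickening]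
    simp only [Set.mem_iInter]
    intro δ hδ
    set C := Metric.cthickening δ (convexHull ℝ (V (x t)))
    have hCc : Convex ℝ C := (convex_convexHull ℝ _).cthickening δ
    have hCcl : IsClosed C := Metric.isClosed_cthickening
    obtain ⟨κ, hκ, happ⟩ := h.approx (x t) δ hδ
    have hΓ1 : 0 < Γ + 1 := by linarith [h.Γ_nonneg]
    -- Displacement over elapsed time is the `ε`-weighted mean of the directions `g m` used between
    -- the two times. The bound on `a` keeps those iterates within `κ` of `x t`, so the directions
    -- lie in the closed convex set `C`.
    have hsmall : ∀ a ∈ Set.Ioo 0 (κ / (2 * (Γ + 1))), a⁻¹ • (x t - x (t + a)) ∈ C := by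
      intro a ha
      have hta : 0 < t + a := by linarith [ha.1]
      have hΓa : Γ * a < κ / 2 := by
        have := (lt_div_iff₀ (by positivity)).mp ha.2
        nlinarith [ha.1]
      have hW : Tendsto (fun k => elapsed ε (h.step.reach k (t + a)) -
          elapsed ε (h.step.reach k t)) 𝒰 (𝓝 a) := by
        have := ((h.step.tendsto_elapsed_reach (t + a)).mono_left h𝒰).sub
          ((h.step.tendsto_elapsed_reach t).mono_left h𝒰)
        simpa [max_eq_left ht.le, max_eq_left hta.le] using this
      have hlim : Tendsto (fun k => (elapsed ε (h.step.reach k (t + a)) -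
          elapsed ε (h.step.reach k t))⁻¹ •
            (r (h.step.reach k t) - r (h.step.reach k (t + a)))) 𝒰
          (𝓝 (a⁻¹ • (x t - x (t + a)))) :=
        (hW.inv₀ ha.1.ne').smul ((hx t).sub (hx (t + a)))
      refine hCcl.mem_of_tendsto hlim ?_
      have hnear : ∀ᶠ k in (𝒰 : Filter ℕ), ‖r (h.step.reach k t) - x t‖ < κ / 2 := by
        have := ((hx t).sub_const (x t)).norm
        rw [sub_self, norm_zero] at this
        exact this.eventually_lt_const (by positivity)
      have happ' : ∀ᶠ k in (𝒰 : Filter ℕ), ∀ m ≥ k, ‖r m - x t‖ < κ →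
          ∃ p ∈ V (x t), ‖g m - p‖ < δ :=
        h𝒰 (eventually_forall_ge_atTop.mpr happ)
      filter_upwards [hnear, happ', hW.eventually_const_lt ha.1] with k hk1 hk2 hk3
      set N := h.step.reach k t
      set N' := h.step.reach k (t + a)
      have hNN : N ≤ N' := h.step.reach_mono k (by linarith [ha.1])
      have hkN : k ≤ N := h.step.le_reach k t
      have hgC : ∀ m ∈ Finset.Ico N N', g m ∈ C := by
        intro m hm
        rw [Finset.mem_Ico] at hm
        have h1 := h.step.elapsed_lt_of_lt_reach (hkN.trans hm.1) hm.2
        have h2 := h.step.elapsed_add_le k t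
        have h3 := h.norm_sub_le_elapsed hm.1
        have h4 : Γ * (elapsed ε m - elapsed ε N) ≤ Γ * a :=
          mul_le_mul_of_nonneg_left (by linarith) h.Γ_nonneg
        have h5 := norm_sub_le_norm_sub_add_norm_sub (r m) (r N) (x t)
        obtain ⟨p, hp, hgp⟩ := hk2 m (hkN.trans hm.1) (by linarith)
        exact Metric.mem_cthickening_of_dist_le _ p _ _ (subset_convexHull ℝ _ hp)
          (by rw [dist_eq_norm]; exact hgp.le)
      have hsum : ∑ m ∈ Finset.Ico N N', ε m = elapsed ε N' - elapsed ε N :=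
        Finset.sum_Ico_eq_sub _ hNN
      rw [h.sub_eq_sum hNN, ← hsum]
      exact hCc.centerMass_mem (fun m _ => (h.step.1 m).le) (by rw [hsum]; exact hk3) hgC
    have hs := (hx'.tendsto_slope_zero_right).neg
    refine hCcl.mem_of_tendsto hs ?_
    have hpos : 0 < κ / (2 * (Γ + 1)) := by positivity
    filter_upwards [Ioo_mem_nhdsGT hpos] with a ha
    have := hsmall a ha
    rwa [← smul_neg, neg_sub]

end IsPerturbedDescent

/-! ### Strict decrease along limit curves; convergence of values and criticality -/

theorem exists_inner_pos_of_zero_notMem {n : ℕ} {s : Set (Vec n)} (hs : s.Finite)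
    (h : (0 : Vec n) ∉ convexHull ℝ s) : ∃ (d : Vec n) (c : ℝ), 0 < c ∧ ∀ g ∈ s, c ≤ ⟪g, d⟫ := by
  obtain ⟨f, c, hc, hf⟩ := geometric_hahn_banach_point_closed (convex_convexHull ℝ s)
    (hs.isClosed_convexHull ℝ) h
  rw [map_zero] at hc
  refine ⟨(InnerProductSpace.toDual ℝ (Vec n)).symm f, c, hc, fun g hg => ?_⟩
  rw [real_inner_comm, InnerProductSpace.toDual_symm_apply]
  exact (hf g (subset_convexHull ℝ s hg)).le

namespace GridGame.IsContractive

variable {n : ℕ} {G : GridGame n} {η θ : ℝ} (hG : G.IsContractive η θ)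
include hG

theorem exists_pieceGrads_near (w : Vec n) {δ : ℝ} (hδ : 0 < δ) :
    ∀ᶠ a in 𝓝 w, ∀ g ∈ G.pieceGrads η a, ∃ p ∈ G.pieceGrads η w, ‖g - p‖ < δ := by
  obtain ⟨κ, hκ, h⟩ := exists_hgrad_near (G := G) (η := η) w hδ
  have h1 : ∀ᶠ a in 𝓝 w, ‖a - w‖ < κ := eventually_norm_sub_lt w hκ
  have h2 : ∀ᶠ a in 𝓝 w, ‖G.nashEq a - G.nashEq w‖ < κ :=
    hG.continuous_nashEq.continuousAt.eventually (eventually_norm_sub_lt _ hκ)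
  have h3 : ∀ᶠ a in 𝓝 w, ‖G.nashPre η a - G.nashPre η w‖ < κ :=
    hG.continuous_nashPre.continuousAt.eventually (eventually_norm_sub_lt _ hκ)
  filter_upwards [h1, h2, h3] with a ha1 ha2 ha3
  rintro _ ⟨χ, hχ, rfl⟩
  exact h a (G.nashEq a) (G.nashPre η a) (G.sens η χ) ha1 ha2 ha3 χ hχ (by simpa using hκ)

/-- Along solutions of the differential inclusion started at a noncritical point, the relaxed
objective strictly decreases. -/
theorem phiE_lt_of_curve {x : ℝ → Vec n} {Γ : NNReal} (hx : LipschitzWith Γ x)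
    (hincl : ∀ t, 0 < t → ∀ x', HasDerivAt x x' t → -x' ∈ convexHull ℝ (G.pieceGrads η (x t)))
    (hcrit : (0 : Vec n) ∉ convexHull ℝ (G.pieceGrads η (x 0))) :
    ∃ τ₀ > 0, ∀ τ, 0 < τ → τ ≤ τ₀ → G.phiE (x τ) < G.phiE (x 0) := by
  obtain ⟨d, c, hc, hd⟩ := exists_inner_pos_of_zero_notMem (finite_pieceGrads _) hcrit
  have hδ : 0 < c / (2 * (‖d‖ + 1)) := by positivity
  have hnear : ∀ᶠ t in 𝓝 (0 : ℝ), ∀ g ∈ G.pieceGrads η (x t), c / 2 ≤ ⟪g, d⟫ := by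
    filter_upwards [hx.continuous.continuousAt.eventually (hG.exists_pieceGrads_near (x 0) hδ)]
      with t ht g hg
    obtain ⟨p, hp, hgp⟩ := ht g hg
    have h1 := hd p hp
    have h2 := abs_le.mp (abs_real_inner_le_norm (g - p) d)
    rw [inner_sub_left] at h2
    have h3 : ‖g - p‖ * ‖d‖ ≤ c / 2 := by
      have h4 := (lt_div_iff₀ (by positivity)).mp hgp
      nlinarith [norm_nonneg (g - p), norm_nonneg d]
    linarith [h2.1]
  obtain ⟨τ₀, hτ₀, hball⟩ := Metric.eventually_nhds_iff.mp hnear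
  refine ⟨τ₀ / 2, by positivity, fun τ hτ hττ => ?_⟩
  set u : ℝ → ℝ := fun t => G.phiE (x t) with hu
  set κ : ℝ := (c / (2 * (‖d‖ + 1))) ^ 2 with hκdef
  have hκ : 0 < κ := by positivity
  have hac : AbsolutelyContinuousOnInterval u 0 τ := by
    have h1 : LocallyLipschitz u := hG.locallyLipschitz_phiE.comp hx.locallyLipschitz
    obtain ⟨K, hK⟩ := (h1.locallyLipschitzOn (s := Set.uIcc 0 τ)).exists_lipschitzOnWith_of_compact
      isCompact_uIcc
    exact hK.absolutelyContinuousOnInterval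
  have hae : ∀ᵐ t : ℝ, t ∈ Set.Ioc 0 τ → deriv u t ≤ -κ := by
    have hq : LipschitzWith _ fun t => G.nashEq (x t) := hG.lipschitzWith_nashEq.comp hx
    filter_upwards [hx.ae_differentiableAt_real, hq.ae_differentiableAt_real] with t ht1 ht2 ht
    have hx' := ht1.hasDerivAt
    set x' := deriv x t
    have hmem := hincl t ht.1 x' hx'
    -- The common value passes to the hull element `-x'`, so the derivative is `-‖x'‖²`. Separation
    -- from zero in direction `d` bounds `‖x'‖` below.
    have hder : ∀ g ∈ G.pieceGrads η (x t), ⟪g, x'⟫ = deriv u t := fun g hg =>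
      (hG.hasDerivAt_phiE_comp hx' ht2 hg).deriv.symm
    have h1 := inner_eq_of_mem_convexHull hder hmem
    rw [inner_neg_left, real_inner_self_eq_norm_sq] at h1
    have h2 := le_inner_of_mem_convexHull
      (hball (by rw [Real.dist_eq, sub_zero, abs_of_pos ht.1]; linarith [ht.2])) hmem
    have h3 := (le_abs_self _).trans (abs_real_inner_le_norm (-x') d)
    rw [norm_neg] at h3
    have h4 : c / (2 * (‖d‖ + 1)) ≤ ‖x'‖ := by
      rw [div_le_iff₀ (by positivity)]
      nlinarith [norm_nonneg x', norm_nonneg d]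
    have h5 : κ ≤ ‖x'‖ ^ 2 := pow_le_pow_left₀ hδ.le h4 2
    linarith
  have hint := hac.integral_deriv_eq_sub
  have hle : ∫ t in (0 : ℝ)..τ, deriv u t ≤ ∫ _ in (0 : ℝ)..τ, -κ := by
    rw [intervalIntegral.integral_of_le hτ.le, intervalIntegral.integral_of_le hτ.le]
    exact MeasureTheory.setIntegral_mono_ae_restrict hac.intervalIntegrable_deriv.1
      intervalIntegrable_const.1 ((MeasureTheory.ae_restrict_iff' measurableSet_Ioc).mpr hae)
  rw [hint, intervalIntegral.integral_const, smul_eq_mul, sub_zero] at hle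
  have : 0 < τ * κ := mul_pos hτ hκ
  change u τ < u 0
  linarith

section Descent

variable {Γ : ℝ} {ε : ℕ → ℝ} {r g : ℕ → Vec n}
  (h : IsPerturbedDescent (G.pieceGrads η) Γ ε r g)
include h

theorem exists_descent {𝒰 : Ultrafilter ℕ} (h𝒰 : (𝒰 : Filter ℕ) ≤ atTop) {w : Vec n}
    (hw : Tendsto r 𝒰 (𝓝 w)) (hcrit : (0 : Vec n) ∉ convexHull ℝ (G.pieceGrads η w)) {τ : ℝ}
    (hτ : 0 < τ) : ∃ t y, 0 < t ∧ t ≤ τ ∧ y < G.phiE w ∧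
      Tendsto (fun k => G.phiE (r (h.step.reach k t))) 𝒰 (𝓝 y) := by
  obtain ⟨x, rfl, hlip, hlim, hincl⟩ := h.exists_limit_curve h𝒰 hw finite_pieceGrads
  obtain ⟨τ₀, hτ₀, hlt⟩ := hG.phiE_lt_of_curve hlip hincl hcrit
  exact ⟨min τ τ₀, G.phiE (x (min τ τ₀)), lt_min hτ hτ₀, min_le_left _ _,
    hlt _ (lt_min hτ hτ₀) (min_le_right _ _),
    (hG.continuous_phiE.tendsto _).comp (hlim _)⟩

/-- Noncritical levels are dense, so it suffices to exclude infinitely many upcrossings starting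
from such a level `a`. They would accumulate at a noncritical point with value `a`, from which the
limit curve first goes below `a`, whereas an upcrossing stays above `a` after its start. -/
theorem tendsto_phiE : ∃ ℓ, Tendsto (fun k => G.phiE (r k)) atTop (𝓝 ℓ) := by
  obtain ⟨B, hB⟩ := h.bounded
  have hbdd : Bornology.IsBounded (Set.range fun k => G.phiE (r k)) := by
    refine (((isCompact_closedBall (0 : Vec n) B).image hG.continuous_phiE).isBounded).subset ?_
    rintro _ ⟨k, rfl⟩
    exact ⟨r k, by simpa using hB k, rfl⟩
  have hdense : Dense (G.phiE '' {w | (0 : Vec n) ∈ convexHull ℝ (G.pieceGrads η w)})ᶜ :=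
    hG.finite_critical_values.countable.dense_compl ℝ
  refine tendsto_of_no_upcrossings hdense ?_ hbdd.bddAbove.isBoundedUnder_of_range
    hbdd.bddBelow.isBoundedUnder_of_range
  rintro a ha b - hab ⟨hfa, hfb⟩
  -- The last indices at or below level `a` before the values exceed `b`.
  set K : Set ℕ := {k | G.phiE (r k) ≤ a ∧ ∃ m, k < m ∧ b < G.phiE (r m) ∧
    ∀ i, k < i → i ≤ m → a < G.phiE (r i)} with hK
  have hfreq : ∃ᶠ k in atTop, k ∈ K := by
    classical
    rw [frequently_atTop] at hfa hfb ⊢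
    intro N
    obtain ⟨k₀, hk₀, hk₀a⟩ := hfa N
    obtain ⟨m, hm, hmb⟩ := hfb k₀
    set k := Nat.findGreatest (fun k => G.phiE (r k) ≤ a) m with hkdef
    have hk : G.phiE (r k) ≤ a := Nat.findGreatest_spec (P := fun k => G.phiE (r k) ≤ a) hm hk₀a.le
    have hkm : k ≤ m := Nat.findGreatest_le m
    have hkk : k₀ ≤ k := Nat.le_findGreatest hm hk₀a.le
    refine ⟨k, hk₀.trans hkk, hk, m, lt_of_le_of_ne hkm ?_, hmb, fun i hi him => ?_⟩
    · intro hkm'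
      rw [hkm'] at hk
      linarith
    · exact not_le.mp (Nat.findGreatest_is_greatest hi him)
  have : (atTop ⊓ 𝓟 K).NeBot := frequently_mem_iff_neBot.mp hfreq
  obtain ⟨𝒰, w, h𝒰, hw⟩ := h.exists_ultrafilter_limit (F := atTop ⊓ 𝓟 K)
  have h𝒰top : (𝒰 : Filter ℕ) ≤ atTop := h𝒰.trans inf_le_left
  have h𝒰K : ∀ᶠ k in (𝒰 : Filter ℕ), k ∈ K := (h𝒰.trans inf_le_right) (mem_principal_self K)
  have hfw : Tendsto (fun k => G.phiE (r k)) 𝒰 (𝓝 (G.phiE w)) :=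
    (hG.continuous_phiE.tendsto w).comp hw
  have hw1 : Tendsto (fun k => r (k + 1)) 𝒰 (𝓝 w) := by
    simpa using (h.tendsto_succ_sub.mono_left h𝒰top).add hw
  have hfw1 : Tendsto (fun k => G.phiE (r (k + 1))) 𝒰 (𝓝 (G.phiE w)) :=
    (hG.continuous_phiE.tendsto w).comp hw1
  have hwa : G.phiE w = a := by
    refine le_antisymm (le_of_tendsto hfw (h𝒰K.mono fun k hk => hk.1)) ?_
    refine ge_of_tendsto hfw1 (h𝒰K.mono fun k hk => ?_)
    obtain ⟨-, m, hkm, -, hi⟩ := hk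
    exact (hi (k + 1) (Nat.lt_succ_self k) hkm).le
  have hcrit : (0 : Vec n) ∉ convexHull ℝ (G.pieceGrads η w) := fun hc => ha ⟨w, hc, hwa⟩
  obtain ⟨κ, hκ, hball⟩ := Metric.eventually_nhds_iff.mp
    (hG.continuous_phiE.continuousAt.eventually_lt_const (hwa.trans_lt hab))
  have hΓ := h.Γ_nonneg
  obtain ⟨t, y, ht, htτ, hy, hlim⟩ := hG.exists_descent h h𝒰top hw hcrit
    (τ := κ / (2 * (Γ + 1))) (by positivity)
  have hΓt : Γ * t ≤ κ / 2 := by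
    have := (le_div_iff₀ (by positivity)).mp htτ
    nlinarith
  have hnear : ∀ᶠ k in (𝒰 : Filter ℕ), ‖r k - w‖ < κ / 2 := by
    have := (hw.sub_const w).norm
    rw [sub_self, norm_zero] at this
    exact this.eventually_lt_const (by positivity)
  -- Up to time `t` the iterates stay in the ball around `w` where the value is below `b`, so the
  -- upcrossing is still under way at `reach k t`.
  have : a ≤ y := by
    refine ge_of_tendsto hlim ?_
    filter_upwards [h𝒰K, hnear] with k hk hkn
    obtain ⟨-, m, hkm, hbm, hi⟩ := hk
    refine (hi _ (h.step.lt_reach k ht) ?_).le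
    by_contra! hlt
    have h1 := h.step.elapsed_lt_of_lt_reach hkm.le hlt
    have h2 := h.norm_sub_le_elapsed hkm.le
    have h3 : Γ * (elapsed ε m - elapsed ε k) ≤ Γ * t :=
      mul_le_mul_of_nonneg_left (by linarith) hΓ
    have h4 := norm_sub_le_norm_sub_add_norm_sub (r m) (r k) w
    have h5 := hball (y := r m) (by rw [dist_eq_norm]; linarith)
    linarith
  linarith

/-- From a noncritical accumulation point the values would drop strictly within bounded time, while
at both ends they have the same limit. -/
theorem zero_mem_of_mapClusterPt {w : Vec n} (hw : MapClusterPt w atTop r) :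
    (0 : Vec n) ∈ convexHull ℝ (G.pieceGrads η w) := by
  by_contra hcrit
  obtain ⟨ℓ, hℓ⟩ := hG.tendsto_phiE h
  obtain ⟨𝒰, h𝒰, hlim⟩ := mapClusterPt_iff_ultrafilter.mp hw
  obtain ⟨t, y, -, -, hy, hty⟩ := hG.exists_descent h h𝒰 hlim hcrit one_pos
  have h1 : G.phiE w = ℓ := tendsto_nhds_unique ((hG.continuous_phiE.tendsto w).comp hlim)
    (hℓ.mono_left h𝒰)
  have h2 : y = ℓ := tendsto_nhds_unique hty
    ((hℓ.comp (h.step.tendsto_reach t)).mono_left h𝒰)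
  linarith

theorem descent_converges :
    (∃ w : Vec n, MapClusterPt w atTop r ∧
      Tendsto (fun k => G.phiE (r k)) atTop (𝓝 (G.phiE w))) ∧
    ∀ w : Vec n, MapClusterPt w atTop r → IsCritical G.phiE w := by
  refine ⟨?_, fun w hw => hG.isCritical_of_zero_mem (hG.zero_mem_of_mapClusterPt h hw)⟩
  obtain ⟨ℓ, hℓ⟩ := hG.tendsto_phiE h
  obtain ⟨𝒰, w, h𝒰, hlim⟩ := h.exists_ultrafilter_limit (F := atTop)
  have h1 : G.phiE w = ℓ := tendsto_nhds_unique ((hG.continuous_phiE.tendsto w).comp hlim)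
    (hℓ.mono_left h𝒰)
  exact ⟨w, mapClusterPt_iff_ultrafilter.mpr ⟨𝒰, h𝒰, hlim⟩, h1 ▸ hℓ⟩

end Descent

end GridGame.IsContractive

/-! ### Boundedness of runs -/

theorem exists_bound_of_le_add_mul {u c : ℕ → ℝ} {a : ℝ} (hu : ∀ k, 0 ≤ u k)
    (hc : Tendsto c atTop (𝓝 0)) (h : ∀ k, u (k + 1) ≤ a + c k * u k) : ∃ B, ∀ k, u k ≤ B := by
  obtain ⟨N, hN⟩ := eventually_atTop.mp (hc.eventually_le_const (show (0 : ℝ) < 1 / 2 by norm_num))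
  set B := ∑ i ∈ Finset.range (N + 1), u i + 2 * |a| with hB
  have hfin : ∀ k ≤ N, u k ≤ B := by
    intro k hk
    have := Finset.single_le_sum (fun i _ => hu i) (Finset.mem_range.mpr (Nat.lt_succ_of_le hk))
    linarith [abs_nonneg a]
  have hBa : 2 * a ≤ B := by
    have := Finset.sum_nonneg fun i (_ : i ∈ Finset.range (N + 1)) => hu i
    linarith [le_abs_self a]
  refine ⟨B, fun k => ?_⟩
  rcases le_total k N with hk | hk
  · exact hfin k hk
  · induction k, hk using Nat.le_induction with
    | base => exact hfin N le_rfl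
    | succ k hk ih =>
      have h1 := h k
      have h2 := mul_le_mul_of_nonneg_right (hN k hk) (hu k)
      linarith

/-- A sequence that either is reset below a fixed level or grows by at most a multiple of a
geometrically decaying quantity is bounded above. -/
theorem exists_bound_of_reset {u c : ℕ → ℝ} {θ W D S : ℝ} (h0 : 0 ≤ θ) (h1 : θ < 1) (hW : 0 ≤ W)
    (hc : ∀ k, 0 ≤ c k) (hcS : ∀ k, c k ≤ S)
    (h : ∀ k, (c (k + 1) ≤ θ * c k ∧ u (k + 2) ≤ u (k + 1) + W * c (k + 1)) ∨ u (k + 2) ≤ D) :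
    ∃ B, ∀ k, u k ≤ B := by
  have hθ : 0 < 1 - θ := by linarith
  -- The solution of `(W + m) θ = m`. It makes `u (k + 1) + m * c k` nonincreasing while no reset
  -- occurs.
  set m := W * θ / (1 - θ) with hm
  have hm0 : 0 ≤ m := by positivity
  have hmeq : (W + m) * θ = m := by
    rw [hm]
    field_simp
    ring
  set B := max (u 1 + m * c 0) (D + m * S) with hB
  have hP : ∀ k, u (k + 1) + m * c k ≤ B := by
    intro k
    induction k with
    | zero => exact le_max_left _ _
    | succ k ih =>
      rcases h k with ⟨h2, h3⟩ | h2
      · have h4 : (W + m) * c (k + 1) ≤ (W + m) * (θ * c k) :=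
          mul_le_mul_of_nonneg_left h2 (by positivity)
        rw [← mul_assoc, hmeq] at h4
        have : u (k + 1 + 1) + m * c (k + 1) ≤ u (k + 1) + m * c k := by linarith
        exact this.trans ih
      · have := mul_le_mul_of_nonneg_left (hcS (k + 1)) hm0
        exact (add_le_add h2 this).trans (le_max_right _ _)
  refine ⟨max (u 0) B, fun k => ?_⟩
  cases k with
  | zero => exact le_max_left _ _
  | succ k =>
    have := mul_nonneg hm0 (hc k)
    exact le_max_of_le_right (by linarith [hP k])

namespace GridGame

variable {n : ℕ} (G : GridGame n)

/-- A run of the algorithm in which the estimates `z k` used at the reference `r k` were obtained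
by the inner loop at a reference `ρ k` that lags behind by at most one update. -/
structure IsEstimatedRun (η : ℝ) (ε σ : ℕ → ℝ) (ρ r : ℕ → Vec n)
    (z : ℕ → Vec n × Matrix (Fin n) (Fin n) ℝ) : Prop where
  returns : ∀ k, G.InnerReturns η (ρ (k + 1)) (z k) (σ k) (z (k + 1))
  update : ∀ k, r (k + 1) = r k - ε k • G.hypergrad (r k) (z k).1 (z k).2
  inBox : G.InBox (z 0).1
  lag : ∀ k, ‖r (k + 1) - ρ (k + 1)‖ ≤ ‖r (k + 1) - r k‖

theorem adj_eq (r q : Vec n) : G.adj r q = G.adj 0 q - G.γ • r := by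
  simp only [adj]
  module

theorem exists_adj_bound : ∃ A, 0 ≤ A ∧ ∀ ξ, G.InBox ξ → ‖G.adj 0 ξ‖ ≤ A := by
  have hc : Continuous fun q => G.adj 0 q :=
    Continuous.comp (g := fun p : Vec n × Vec n => G.adj p.1 p.2)
      (f := fun q : Vec n => ((0 : Vec n), q)) G.continuous_adj (by fun_prop)
  obtain ⟨A, hA⟩ := (isCompact_closedBall (0 : Vec n) G.boxBound).exists_bound_of_continuousOn
    hc.continuousOn
  exact ⟨max A 0, le_max_right _ _, fun ξ hξ =>
    (hA ξ (by simpa using hξ.norm_le)).trans (le_max_left _ _)⟩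

variable {G}

/-- If the rows of `S` at coordinates where `ρ` is large vanish, then the pairing in the
hypergradient formula is controlled by the image of `S`. -/
theorem abs_inner_adj_le (hγ : 0 < G.γ) {S : Vec n →L[ℝ] Vec n} {ρ r ξ : Vec n} {A K₀ : ℝ}
    (hA0 : 0 ≤ A) (hK : 0 ≤ K₀) (hA : ‖G.adj 0 ξ‖ ≤ A)
    (hS : ∀ j, K₀ < |ρ j| → ∀ d, S d j = 0) (d : Vec n) :
    |⟪G.adj r ξ, S d⟫| ≤ n * (A + G.γ * (K₀ + ‖r - ρ‖)) * ‖S d‖ := by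
  have hpos : 0 ≤ A + G.γ * (K₀ + ‖r - ρ‖) := by positivity
  rw [PiLp.inner_apply]
  refine (Finset.abs_sum_le_sum_abs _ _).trans ?_
  have : ∀ j ∈ Finset.univ, |⟪G.adj r ξ j, S d j⟫| ≤ (A + G.γ * (K₀ + ‖r - ρ‖)) * ‖S d‖ := by
    intro j _
    by_cases hj : K₀ < |ρ j|
    · rw [hS j hj d, inner_zero_right, abs_zero]
      positivity
    · rw [RCLike.inner_apply, conj_trivial, abs_mul, mul_comm]
      refine mul_le_mul ?_ (abs_apply_le_norm _ _) (abs_nonneg _) hpos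
      rw [adj_eq, PiLp.sub_apply, PiLp.smul_apply, smul_eq_mul]
      refine (abs_sub _ _).trans (add_le_add ((abs_apply_le_norm _ _).trans hA) ?_)
      rw [abs_mul, abs_of_pos hγ]
      refine mul_le_mul_of_nonneg_left ?_ hγ.le
      have h1 : |r j| ≤ |ρ j| + |r j - ρ j| := by
        have := abs_add_le (ρ j) (r j - ρ j)
        rwa [add_sub_cancel] at this
      have h2 : |r j - ρ j| ≤ ‖r - ρ‖ := abs_apply_le_norm (r - ρ) j
      linarith [not_lt.mp hj]
  refine (Finset.sum_le_sum this).trans ?_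
  simp [mul_assoc]

namespace IsContractive

variable {η θ : ℝ} (hG : G.IsContractive η θ) {ε σ : ℕ → ℝ} {ρ r : ℕ → Vec n}
  {z : ℕ → Vec n × Matrix (Fin n) (Fin n) ℝ}
include hG

theorem exists_inactive_threshold : ∃ K₀ : ℝ, 0 ≤ K₀ ∧
    ∀ {ρ : Vec n} {z z' : Vec n × Matrix (Fin n) (Fin n) ℝ} {σ : ℝ} {i : Fin n},
      G.InnerReturns η ρ z σ z' → G.InBox z.1 →
      (K₀ < |ρ i| → (∀ d, matOp z'.2 d i = 0) ∧ ‖matOp z'.2 (EuclideanSpace.single i 1)‖ ≤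
        θ * ‖matOp z.2 (EuclideanSpace.single i 1)‖) ∧
      (K₀ < ρ i → z'.1 i = G.qlo i) ∧ (ρ i < -K₀ → z'.1 i = G.qhi i) := by
  obtain ⟨K₀, hK₀, hK⟩ := hG.exists_threshold
  refine ⟨K₀, hK₀, fun {ρ z z' σ i} hret hz => ⟨fun hi => ?_, fun hi => ?_, fun hi => ?_⟩⟩
  · refine hG.innerReturns_inactive hret fun ξ hξ => ?_
    have hbox := hG.box i
    have hor : G.preProj η ρ ξ i < G.qlo i ∨ G.qhi i < G.preProj η ρ ξ i := by
      rcases lt_abs.mp hi with h | h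
      · exact Or.inl ((hK ρ ξ i hξ).1 h)
      · exact Or.inr ((hK ρ ξ i hξ).2 (by linarith))
    rcases G.pattern_eq_or (G.preProj η ρ ξ) i with h | h
    · rcases hor with h' | h'
      · exact absurd h' (not_lt.mpr h.2.1)
      · exact absurd h' (not_lt.mpr h.2.2)
    · exact h.1
  · exact (hG.innerReturns_fst_apply hret hz).1 fun ξ hξ => (hK ρ ξ i hξ).1 hi
  · exact (hG.innerReturns_fst_apply hret hz).2 fun ξ hξ => (hK ρ ξ i hξ).2 hi

variable (hrun : G.IsEstimatedRun η ε σ ρ r z)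
include hrun

theorem run_inBox (k : ℕ) : G.InBox (z k).1 := by
  cases k with
  | zero => exact hrun.inBox
  | succ k => exact hG.innerReturns_inBox (hrun.returns k)

theorem exists_run_sens_bound : ∃ S, 0 ≤ S ∧ ∀ k d, ‖matOp (z k).2 d‖ ≤ S * ‖d‖ := by
  refine ⟨max ‖matOp (z 0).2‖ (η * G.γ / (1 - θ)), le_max_of_le_left (norm_nonneg _), fun k => ?_⟩
  induction k with
  | zero =>
    intro d
    exact ((matOp (z 0).2).le_opNorm d).trans
      (mul_le_mul_of_nonneg_right (le_max_left _ _) (norm_nonneg _))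
  | succ k ih => exact hG.innerReturns_norm_le (hrun.returns k) (le_max_right _ _) ih

/-- Proved before the references are known to be bounded: large entries of `ρ` meet zero rows of the
sensitivity. Only the lag `r - ρ` remains, at most `ε k` times the previous hypergradient, and since
`ε k → 0` the resulting recursion is bounded. -/
theorem exists_run_hypergrad_bound (hε : IsStepSeq ε) :
    ∃ Γ, ∀ k, ‖G.hypergrad (r k) (z k).1 (z k).2‖ ≤ Γ := by
  obtain ⟨K₀, hK₀, hK⟩ := hG.exists_inactive_threshold
  obtain ⟨S, hS0, hS⟩ := hG.exists_run_sens_bound hrun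
  obtain ⟨A, hA0, hA⟩ := G.exists_adj_bound
  have hγ := hG.γ_pos
  refine exists_bound_of_le_add_mul (c := fun k => n * G.γ * S * ε k)
    (a := G.γ * G.boxBound + n * (A + G.γ * K₀) * S) (fun k => norm_nonneg _)
    (by simpa using hε.2.1.const_mul (n * G.γ * S)) fun k => ?_
  set v := G.hypergrad (r (k + 1)) (z (k + 1)).1 (z (k + 1)).2 with hv
  have hξ := hG.run_inBox hrun (k + 1)
  have hlag : ‖r (k + 1) - ρ (k + 1)‖ ≤ ε k * ‖G.hypergrad (r k) (z k).1 (z k).2‖ := by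
    refine (hrun.lag k).trans ?_
    rw [hrun.update, sub_sub_cancel_left, norm_neg, norm_smul, Real.norm_of_nonneg (hε.1 k).le]
  have h1 := abs_inner_adj_le (r := r (k + 1)) hγ hA0 hK₀ (hA _ hξ)
    (fun j hj => ((hK (hrun.returns k) (hG.run_inBox hrun k)).1 hj).1) v
  have h2 : ‖v‖ ^ 2 ≤ (G.γ * G.boxBound + n * (A + G.γ * (K₀ +
      ‖r (k + 1) - ρ (k + 1)‖)) * S) * ‖v‖ := by
    have e : ‖v‖ ^ 2 = -G.γ * ⟪(z (k + 1)).1, v⟫ +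
        ⟪G.adj (r (k + 1)) (z (k + 1)).1, matOp (z (k + 1)).2 v⟫ := by
      rw [← inner_hgrad, ← hypergrad_eq_hgrad, ← hv, real_inner_self_eq_norm_sq]
    have h3 : -G.γ * ⟪(z (k + 1)).1, v⟫ ≤ G.γ * (G.boxBound * ‖v‖) := by
      rw [neg_mul, ← mul_neg]
      refine mul_le_mul_of_nonneg_left ?_ hγ.le
      refine (neg_le_abs _).trans ((abs_real_inner_le_norm _ _).trans ?_)
      exact mul_le_mul_of_nonneg_right hξ.norm_le (norm_nonneg _)
    have h4 := mul_le_mul_of_nonneg_left (hS (k + 1) v)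
      (show 0 ≤ n * (A + G.γ * (K₀ + ‖r (k + 1) - ρ (k + 1)‖)) by positivity)
    have h5 := (le_abs_self _).trans h1
    rw [e]
    calc _ ≤ G.γ * (G.boxBound * ‖v‖) +
          n * (A + G.γ * (K₀ + ‖r (k + 1) - ρ (k + 1)‖)) * (S * ‖v‖) :=
        add_le_add h3 (h5.trans h4)
      _ = _ := by ring
  have h3 : ‖v‖ ≤ G.γ * G.boxBound + n * (A + G.γ * (K₀ + ‖r (k + 1) - ρ (k + 1)‖)) * S := by
    by_contra! hlt
    have hpos : 0 < ‖v‖ := by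
      refine lt_of_le_of_lt ?_ hlt
      have : 0 ≤ G.boxBound := norm_nonneg _
      positivity
    have := mul_lt_mul_of_pos_right hlt hpos
    rw [← sq] at this
    linarith
  have h4 := mul_le_mul_of_nonneg_left hlag (show 0 ≤ n * G.γ * S by positivity)
  linarith

/-- Beyond the threshold `-γ ξᵢ` has the restoring sign or vanishes, and the other term is bounded
by the norm of column `i`, which decays geometrically. The total outward drift of an excursion is
therefore bounded. -/
theorem exists_run_bound (hε : IsStepSeq ε) (hzero : ∀ i, G.qlo i ≤ 0 ∧ 0 ≤ G.qhi i) :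
    ∃ B, ∀ k, ‖r k‖ ≤ B := by
  obtain ⟨K₀, hK₀, hK⟩ := hG.exists_inactive_threshold
  obtain ⟨S, hS0, hS⟩ := hG.exists_run_sens_bound hrun
  obtain ⟨A, hA0, hA⟩ := G.exists_adj_bound
  obtain ⟨Γ, hΓ⟩ := hG.exists_run_hypergrad_bound hrun hε
  obtain ⟨E, hE⟩ := hε.2.1.bddAbove_range
  have hE : ∀ k, ε k ≤ E := fun k => hE ⟨k, rfl⟩
  have hE0 : 0 ≤ E := (hε.1 0).le.trans (hE 0)
  have hΓ0 : 0 ≤ Γ := (norm_nonneg _).trans (hΓ 0)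
  have hγ := hG.γ_pos
  have hstep : ∀ k, ‖r (k + 1) - r k‖ ≤ E * Γ := by
    intro k
    rw [hrun.update, sub_sub_cancel_left, norm_neg, norm_smul, Real.norm_of_nonneg (hε.1 k).le]
    exact mul_le_mul (hE k) (hΓ k) (norm_nonneg _) hE0
  set W := n * (A + G.γ * (K₀ + E * Γ)) with hW
  have hW0 : 0 ≤ W := by positivity
  have hgi : ∀ k i, G.hypergrad (r k) (z k).1 (z k).2 i = -G.γ * (z k).1 i +
      ⟪G.adj (r k) (z k).1, matOp (z k).2 (EuclideanSpace.single i 1)⟫ := by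
    intro k i
    have := inner_hgrad G (r k) (z k).1 (EuclideanSpace.single i 1) (matOp (z k).2)
    rw [← hypergrad_eq_hgrad, EuclideanSpace.inner_single_right,
      EuclideanSpace.inner_single_right] at this
    simpa using this
  have hpair : ∀ k i,
      |⟪G.adj (r (k + 1)) (z (k + 1)).1, matOp (z (k + 1)).2 (EuclideanSpace.single i 1)⟫| ≤
        W * ‖matOp (z (k + 1)).2 (EuclideanSpace.single i 1)‖ := by
    intro k i
    refine (abs_inner_adj_le (r := r (k + 1)) hγ hA0 hK₀ (hA _ (hG.run_inBox hrun (k + 1)))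
      (fun j hj => ((hK (hrun.returns k) (hG.run_inBox hrun k)).1 hj).1) _).trans ?_
    refine mul_le_mul_of_nonneg_right ?_ (norm_nonneg _)
    have := (hrun.lag k).trans (hstep k)
    rw [hW]
    gcongr
  -- The sign `τ` treats upper and lower bounds together. In the reset level `D` below, one `E * Γ`
  -- pays for the lag and one for the next step.
  have hone : ∀ (i : Fin n) (τ : ℝ), (τ = 1 ∨ τ = -1) → ∃ B, ∀ k, τ * r k i ≤ B := by
    intro i τ hτ
    have hτabs : ∀ a : ℝ, |τ * a| = |a| := fun a => by
      rcases hτ with rfl | rfl <;> simp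
    have hstepi : ∀ k, τ * r (k + 1) i ≤ τ * r k i + E * Γ := by
      intro k
      have h1 := (abs_apply_le_norm (r (k + 1) - r k) i).trans (hstep k)
      rw [← hτabs, PiLp.sub_apply, mul_sub] at h1
      linarith [le_abs_self (τ * r (k + 1) i - τ * r k i)]
    have hlagi : ∀ k, τ * r (k + 1) i ≤ τ * ρ (k + 1) i + E * Γ := by
      intro k
      have h1 := (abs_apply_le_norm (r (k + 1) - ρ (k + 1)) i).trans
        ((hrun.lag k).trans (hstep k))
      rw [← hτabs, PiLp.sub_apply, mul_sub] at h1
      linarith [le_abs_self (τ * r (k + 1) i - τ * ρ (k + 1) i)]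
    refine exists_bound_of_reset (c := fun k => ‖matOp (z k).2 (EuclideanSpace.single i 1)‖)
      (S := S) (W := E * W) (D := K₀ + E * Γ + E * Γ) hG.nonneg hG.lt_one (by positivity)
      (fun k => norm_nonneg _) (fun k => by simpa using hS k (EuclideanSpace.single i 1))
      fun k => ?_
    have hKk := hK (i := i) (hrun.returns k) (hG.run_inBox hrun k)
    by_cases hfar : K₀ < τ * ρ (k + 1) i
    · left
      have habs : K₀ < |ρ (k + 1) i| := by
        rw [← hτabs]
        exact hfar.trans_le (le_abs_self _)
      refine ⟨(hKk.1 habs).2, ?_⟩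
      have hsign : τ * (z (k + 1)).1 i ≤ 0 := by
        rcases hτ with rfl | rfl
        · rw [hKk.2.1 (by linarith), one_mul]
          exact (hzero i).1
        · rw [hKk.2.2 (by linarith)]
          linarith [(hzero i).2]
      have h1 : τ * r (k + 1 + 1) i = τ * r (k + 1) i - ε (k + 1) *
          (τ * G.hypergrad (r (k + 1)) (z (k + 1)).1 (z (k + 1)).2 i) := by
        rw [hrun.update (k + 1), PiLp.sub_apply, PiLp.smul_apply, smul_eq_mul]
        ring
      have h2 := hpair k i
      rw [← hτabs] at h2
      have h3 := neg_le_of_abs_le h2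
      have h4 : -(W * ‖matOp (z (k + 1)).2 (EuclideanSpace.single i 1)‖) ≤
          τ * G.hypergrad (r (k + 1)) (z (k + 1)).1 (z (k + 1)).2 i := by
        rw [hgi]
        nlinarith
      have h5 := mul_le_mul_of_nonneg_left h4 (hε.1 (k + 1)).le
      have h6 := mul_le_mul_of_nonneg_right (hE (k + 1))
        (show 0 ≤ W * ‖matOp (z (k + 1)).2 (EuclideanSpace.single i 1)‖ by positivity)
      change τ * r (k + 1 + 1) i ≤ _
      rw [h1]
      linarith
    · right
      have h1 := hstepi (k + 1)
      have h2 := hlagi k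
      change τ * r (k + 1 + 1) i ≤ _
      linarith [not_lt.mp hfar]
  have hboth : ∀ i, ∃ B, ∀ k, |r k i| ≤ B := by
    intro i
    obtain ⟨B₁, hB₁⟩ := hone i 1 (Or.inl rfl)
    obtain ⟨B₂, hB₂⟩ := hone i (-1) (Or.inr rfl)
    refine ⟨max B₁ B₂, fun k => abs_le.mpr ⟨?_, ?_⟩⟩
    · linarith [hB₂ k, le_max_right B₁ B₂]
    · linarith [hB₁ k, le_max_left B₁ B₂]
  choose B hB using hboth
  refine ⟨‖(WithLp.toLp 2 B : Vec n)‖, fun k => norm_le_norm_of_abs_le fun i => ?_⟩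
  exact (hB i k).trans (le_abs_self _)

theorem run_isPerturbedDescent (hε : IsStepSeq ε) (hσ : IsTolSeq σ)
    (hzero : ∀ i, G.qlo i ≤ 0 ∧ 0 ≤ G.qhi i) :
    ∃ Γ, IsPerturbedDescent (G.pieceGrads η) Γ ε r
      (fun k => G.hypergrad (r k) (z k).1 (z k).2) := by
  obtain ⟨Γ, hΓ⟩ := hG.exists_run_hypergrad_bound hrun hε
  refine ⟨Γ, hε, hrun.update, hΓ, hG.exists_run_bound hrun hε hzero, fun w δ hδ => ?_⟩
  have hθ : 0 < 1 - θ := by linarith [hG.lt_one]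
  obtain ⟨κ₀, hκ₀, hnear⟩ := exists_hgrad_near (G := G) (η := η) w hδ
  have hcont : ∀ᶠ a in 𝓝 w, ‖G.nashEq a - G.nashEq w‖ < κ₀ / 2 ∧
      ‖G.nashPre η a - G.nashPre η w‖ < κ₀ / 2 :=
    (hG.continuous_nashEq.continuousAt.eventually (eventually_norm_sub_lt _ (half_pos hκ₀))).and
      (hG.continuous_nashPre.continuousAt.eventually (eventually_norm_sub_lt _ (half_pos hκ₀)))
  obtain ⟨κ₁, hκ₁, hball⟩ := Metric.eventually_nhds_iff.mp hcont
  refine ⟨min κ₀ (κ₁ / 2), lt_min hκ₀ (half_pos hκ₁), ?_⟩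
  have hσ' : ∀ᶠ k in atTop, σ k / (1 - θ) < κ₀ / 2 := by
    have := hσ.2.div_const (1 - θ)
    rw [zero_div] at this
    exact this.eventually_lt_const (half_pos hκ₀)
  have hlag : ∀ᶠ k in atTop, ‖r (k + 1) - ρ (k + 1)‖ < κ₁ / 2 := by
    have h1 : Tendsto (fun k => ε k * Γ) atTop (𝓝 0) := by simpa using hε.2.1.mul_const Γ
    filter_upwards [h1.eventually_lt_const (half_pos hκ₁)] with k hk
    refine lt_of_le_of_lt ((hrun.lag k).trans ?_) hk
    rw [hrun.update, sub_sub_cancel_left, norm_neg, norm_smul, Real.norm_of_nonneg (hε.1 k).le]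
    exact mul_le_mul_of_nonneg_left (hΓ k) (hε.1 k).le
  -- The initial `z 0` need not come from a loop at `ρ 0`, so indices start at one.
  rw [← Filter.map_add_atTop_eq_nat 1, Filter.eventually_map]
  filter_upwards [hσ', hlag] with k hk1 hk2 hrk
  have hr0 := hrk.trans_le (min_le_left _ _)
  have hr1 := hrk.trans_le (min_le_right _ _)
  have hρ : dist (ρ (k + 1)) w < κ₁ := by
    rw [dist_eq_norm]
    have := norm_sub_le_norm_sub_add_norm_sub (ρ (k + 1)) (r (k + 1)) w
    rw [norm_sub_rev (ρ (k + 1)) (r (k + 1))] at this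
    linarith
  obtain ⟨h1, h2⟩ := hball hρ
  obtain ⟨h3, h4, h5⟩ := hG.innerReturns_approx (hrun.returns k)
  have h6 := norm_sub_le_norm_sub_add_norm_sub (z (k + 1)).1 (G.nashEq (ρ (k + 1))) (G.nashEq w)
  have h7 := norm_sub_le_norm_sub_add_norm_sub (G.preProj η (ρ (k + 1)) (z (k + 1)).1)
    (G.nashPre η (ρ (k + 1))) (G.nashPre η w)
  rw [hypergrad_eq_hgrad]
  exact hnear _ _ _ _ hr0 (by linarith) (by linarith) _ (G.pattern_mem_admissible _)
    (by linarith)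

end IsContractive

end GridGame

/-! ### Convergence of both variants and existence of runs -/

namespace GridGame.IsContractive

variable {n : ℕ} {G : GridGame n} {η θ : ℝ} (hG : G.IsContractive η θ)
include hG

/-- The first round is dropped because the initial estimate may lie outside the box. The variants
differ only in the lag: one update for `d = 0`, none for `d = 1`. -/
theorem run_converges (hzero : ∀ i, G.qlo i ≤ 0 ∧ 0 ≤ G.qhi i) {d : Fin 2} {ε σ : ℕ → ℝ}
    {vref ξ : ℕ → Vec n} {s : ℕ → Matrix (Fin n) (Fin n) ℝ} (hε : IsStepSeq ε) (hσ : IsTolSeq σ)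
    (hrun : G.IsRun d η ε σ vref ξ s) :
    (∃ w : Vec n, MapClusterPt w atTop vref ∧
      Tendsto (fun k => G.phiE (vref k)) atTop (𝓝 (G.phiE w))) ∧
    ∀ w : Vec n, MapClusterPt w atTop vref → IsCritical G.phiE w := by
  have hε' : IsStepSeq fun k => ε (k + 1) :=
    ⟨fun k => hε.1 _, hε.2.1.comp (tendsto_add_atTop_nat 1),
      fun h => hε.2.2 ((summable_nat_add_iff 1).mp h)⟩
  have hσ' : ∀ m, IsTolSeq fun k => σ (k + m) := fun m =>
    ⟨fun k => hσ.1 _, hσ.2.comp (tendsto_add_atTop_nat m)⟩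
  have hdesc : ∃ Γ g, IsPerturbedDescent (G.pieceGrads η) Γ (fun k => ε (k + 1))
      (fun k => vref (k + 1)) g := by
    match d, hrun with
    | 0, hrun =>
      have h : G.IsEstimatedRun η (fun k => ε (k + 1)) (fun k => σ (k + 1)) vref
          (fun k => vref (k + 1)) (fun k => (ξ (k + 1), s (k + 1))) :=
        ⟨fun k => hrun.inner_loop (k + 1), fun k => hrun.update (k + 1),
          hG.innerReturns_inBox (hrun.inner_loop 0), fun k => le_rfl⟩
      obtain ⟨Γ, hΓ⟩ := hG.run_isPerturbedDescent h hε' (hσ' 1) hzero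
      exact ⟨Γ, _, hΓ⟩
    | 1, hrun =>
      have h : G.IsEstimatedRun η (fun k => ε (k + 1)) (fun k => σ (k + 2))
          (fun k => vref (k + 1)) (fun k => vref (k + 1)) (fun k => (ξ (k + 2), s (k + 2))) :=
        ⟨fun k => hrun.inner_loop (k + 2), fun k => hrun.update (k + 1),
          hG.innerReturns_inBox (hrun.inner_loop 1), fun k => by simp⟩
      obtain ⟨Γ, hΓ⟩ := hG.run_isPerturbedDescent h hε' (hσ' 2) hzero
      exact ⟨Γ, _, hΓ⟩
  obtain ⟨Γ, g, hdesc⟩ := hdesc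
  have hclust : ∀ w : Vec n, MapClusterPt w atTop (fun k => vref (k + 1)) ↔
      MapClusterPt w atTop vref := by
    intro w
    have : map (fun k => vref (k + 1)) atTop = map vref atTop := by
      conv_rhs => rw [← Filter.map_add_atTop_eq_nat 1, Filter.map_map]
      rfl
    rw [MapClusterPt, MapClusterPt, this]
  obtain ⟨⟨w, hw, hlim⟩, hcrit⟩ := hG.descent_converges hdesc
  refine ⟨⟨w, (hclust w).mp hw, ?_⟩, fun w hw => hcrit w ((hclust w).mpr hw)⟩
  exact (tendsto_add_atTop_iff_nat (f := fun k => G.phiE (vref k)) 1).mp hlim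

/-- The references at which the equilibrium is degenerate lie on finitely many hyperplanes. -/
theorem exists_degenerate_hyperplanes : ∃ H : Set (Vec n × ℝ), H.Finite ∧ (∀ p ∈ H, p.1 ≠ 0) ∧
    ∀ r, (∀ p ∈ H, ⟪p.1, r⟫ ≠ p.2) → DifferentiableAt ℝ G.nashEq r := by
  have key : ∀ (c : Fin n → (Prop × Prop) × (Prop × Prop) × (Prop × Prop)) (i : Fin n),
      ∃ p : Vec n × ℝ, p.1 ≠ 0 ∧ ∀ r, G.cell η r = c →
        (G.nashPre η r i = G.qlo i ∨ G.nashPre η r i = G.qhi i) → ⟪p.1, r⟫ = p.2 := by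
    intro c i
    by_cases hex : ∃ r, G.cell η r = c ∧
        (G.nashPre η r i = G.qlo i ∨ G.nashPre η r i = G.qhi i)
    · obtain ⟨r₀, hr₀, hdeg⟩ := hex
      set χ := G.pattern (G.nashPre η r₀) with hχdef
      have hχ : χ ∈ G.admissible (G.nashPre η r₀) := G.pattern_mem_admissible _
      have hbox := hG.box i
      -- On a kink the pattern counts coordinate `i` as free. This choice makes row `i` of the
      -- sensitivity a nonzero normal vector; with `χ i = 0` that row would vanish.
      have hχi : χ i = 1 := by
        rcases G.pattern_eq_or (G.nashPre η r₀) i with h | ⟨-, h⟩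
        · exact h.1
        · rcases hdeg with h' | h' <;> rcases h with h | h <;> linarith
      have h01 : ∀ j, χ j = 0 ∨ χ j = 1 := fun j =>
        (G.pattern_eq_or (G.nashPre η r₀) j).elim (fun h => Or.inr h.1) fun h => Or.inl h.1
      refine ⟨(ContinuousLinearMap.adjoint (G.sens η χ) (EuclideanSpace.single i 1),
        ⟪ContinuousLinearMap.adjoint (G.sens η χ) (EuclideanSpace.single i 1), r₀⟫), ?_, ?_⟩
      · intro h0
        have h1 : ⟪ContinuousLinearMap.adjoint (G.sens η χ) (EuclideanSpace.single i 1),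
            (EuclideanSpace.single i 1 : Vec n)⟫ = 0 := by
          rw [show ContinuousLinearMap.adjoint (G.sens η χ) (EuclideanSpace.single i 1) = 0 from h0,
            inner_zero_left]
        rw [ContinuousLinearMap.adjoint_inner_left, EuclideanSpace.inner_single_left] at h1
        exact hG.sens_single_ne_zero (abs_pattern_le_one _) hχi h01 (by simpa using h1)
      · intro r hr hdeg'
        rw [← sub_eq_zero, ← inner_sub_right, ContinuousLinearMap.adjoint_inner_left,
          ← hG.nashEq_sub_eq_of_cell_eq (hr₀.trans hr.symm) hχ, EuclideanSpace.inner_single_left]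
        have hc := congrFun (hr₀.trans hr.symm) i
        simp only [cell, Prod.mk.injEq, eq_iff_iff] at hc
        obtain ⟨⟨ha, hb⟩, ⟨hc, hd⟩, -⟩ := hc
        have hproj : ∀ w, G.nashEq w i = max (G.qlo i) (min (G.qhi i) (G.nashPre η w i)) := by
          intro w
          nth_rewrite 1 [← hG.boxProj_nashPre w]
          rfl
        have : G.nashPre η r i = G.nashPre η r₀ i := by
          rcases hdeg with h | h <;> rcases hdeg' with h' | h' <;> rw [h, h'] <;>
            rw [h, h'] at ha hb hc hd <;> simp [hbox] at ha hb hc hd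
        simp [hproj, this]
    · refine ⟨(EuclideanSpace.single i 1, 0), by simp, fun r hr hdeg => ?_⟩
      exact absurd ⟨r, hr, hdeg⟩ hex
  choose p hp0 hp using key
  refine ⟨Set.range fun a : (Fin n → (Prop × Prop) × (Prop × Prop) × (Prop × Prop)) × Fin n =>
    p a.1 a.2, Set.finite_range _, ?_, fun r hr => ?_⟩
  · rintro _ ⟨a, rfl⟩
    exact hp0 _ _
  · have hne : ∀ i, G.nashPre η r i ≠ G.qlo i ∧ G.nashPre η r i ≠ G.qhi i := by
      intro i
      refine ⟨fun h => ?_, fun h => ?_⟩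
      · exact hr _ ⟨(G.cell η r, i), rfl⟩ (hp _ _ r rfl (Or.inl h))
      · exact hr _ ⟨(G.cell η r, i), rfl⟩ (hp _ _ r rfl (Or.inr h))
    refine (hG.hasFDerivAt_nashEq (χ := G.pattern (G.nashPre η r)) fun i => ?_).differentiableAt
    rcases G.pattern_eq_or (G.nashPre η r) i with ⟨h, h1, h2⟩ | h
    · exact Or.inl ⟨h, lt_of_le_of_ne h1 (hne i).1.symm, lt_of_le_of_ne h2 (hne i).2⟩
    · exact Or.inr h

omit hG in
theorem _root_.ae_inner_ne {v : Vec n} (hv : v ≠ 0) (c : ℝ) : ∀ᵐ r : Vec n, ⟪v, r⟫ ≠ c := by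
  rw [MeasureTheory.ae_iff]
  simp only [not_not]
  by_cases hex : ∃ r₀ : Vec n, ⟪v, r₀⟫ = c
  · obtain ⟨r₀, rfl⟩ := hex
    have hker : LinearMap.ker (innerSL ℝ v).toLinearMap ≠ ⊤ := by
      intro h
      have h1 : v ∈ LinearMap.ker (innerSL ℝ v).toLinearMap := h ▸ Submodule.mem_top
      rw [LinearMap.mem_ker] at h1
      exact hv (inner_self_eq_zero.mp h1)
    have h0 := MeasureTheory.Measure.addHaar_submodule (MeasureTheory.volume : MeasureTheory.Measure
      (Vec n)) _ hker
    have : {r : Vec n | ⟪v, r⟫ = ⟪v, r₀⟫} =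
        (fun r => r + -r₀) ⁻¹' (LinearMap.ker (innerSL ℝ v).toLinearMap : Set (Vec n)) := by
      ext r
      simp [← sub_eq_add_neg, inner_sub_right, sub_eq_zero]
    rw [this, MeasureTheory.measure_preimage_add_right, h0]
  · convert MeasureTheory.measure_empty (μ := (MeasureTheory.volume : MeasureTheory.Measure (Vec n)))
    ext r
    simpa using fun h => hex ⟨r, h⟩

omit hG in
-- A line through a point off a hyperplane meets it at most once, so only finitely many step sizes
-- are forbidden.
theorem _root_.exists_step_avoiding {H : Set (Vec n × ℝ)} (hH : H.Finite) {r g : Vec n}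
    (hr : ∀ p ∈ H, ⟪p.1, r⟫ ≠ p.2) {a b : ℝ} (hab : a < b) :
    ∃ e ∈ Set.Icc a b, ∀ p ∈ H, ⟪p.1, r - e • g⟫ ≠ p.2 := by
  have hfin : (⋃ p ∈ H, {e : ℝ | ⟪p.1, r - e • g⟫ = p.2}).Finite := by
    refine hH.biUnion fun p hp => Set.Subsingleton.finite ?_
    intro e he e' he'
    simp only [Set.mem_ofPred_eq, inner_sub_right, inner_smul_right] at he he'
    have h1 : (e - e') * ⟪p.1, g⟫ = 0 := by linarith
    rcases mul_eq_zero.mp h1 with h | h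
    · linarith
    · rw [h, mul_zero, sub_zero] at he
      exact absurd he (hr p hp)
  obtain ⟨e, he, hne⟩ := ((Set.Icc_infinite hab).sdiff hfin).nonempty
  refine ⟨e, he, fun p hp h => hne ?_⟩
  simp only [Set.mem_iUnion]
  exact ⟨p, hp, h⟩

omit hG in
theorem _root_.isStepSeq_of_harmonic {ε : ℕ → ℝ}
    (h : ∀ k : ℕ, ε k ∈ Set.Icc (1 / ((k : ℝ) + 1)) (2 / ((k : ℝ) + 1))) : IsStepSeq ε := by
  have hpos : ∀ k : ℕ, (0 : ℝ) < 1 / ((k : ℝ) + 1) := fun k => by positivity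
  refine ⟨fun k => (hpos k).trans_le (h k).1, ?_, fun hs => ?_⟩
  · refine squeeze_zero (fun k => ((hpos k).trans_le (h k).1).le) (fun k => (h k).2) ?_
    have := (tendsto_one_div_add_atTop_nhds_zero_nat (𝕜 := ℝ)).const_mul 2
    rw [mul_zero] at this
    exact this.congr fun k => mul_one_div _ _
  · have h1 : Summable fun k : ℕ => 1 / ((k : ℝ) + 1) :=
      Summable.of_nonneg_of_le (fun k => (hpos k).le) (fun k => (h k).1) hs
    refine Real.not_summable_one_div_natCast ((summable_nat_add_iff 1).mp ?_)
    simpa using h1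

/-- Off the degenerate hyperplanes the inner loop converges and hence stops. Each step size is
chosen after the loop has returned, between `1 / (k + 1)` and `2 / (k + 1)`, so that the next
reference avoids the hyperplanes too. -/
theorem ae_exists_run (d : Fin 2) {σ : ℕ → ℝ} (hσ : IsTolSeq σ) :
    ∀ᵐ vini : Vec n, ∀ (ξ₀ : Vec n) (s₀ : Matrix (Fin n) (Fin n) ℝ),
      ∃ (ε : ℕ → ℝ) (vref ξ : ℕ → Vec n) (s : ℕ → Matrix (Fin n) (Fin n) ℝ),
        IsStepSeq ε ∧ vref 0 = vini ∧ ξ 0 = ξ₀ ∧ s 0 = s₀ ∧ G.IsRun d η ε σ vref ξ s := by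
  obtain ⟨H, hH, hH0, hdiff⟩ := hG.exists_degenerate_hyperplanes
  have hae : ∀ᵐ vini : Vec n, ∀ p ∈ H, ⟪p.1, vini⟫ ≠ p.2 := by
    rw [MeasureTheory.ae_ball_iff hH.countable]
    exact fun p hp => ae_inner_ne (hH0 p hp) p.2
  filter_upwards [hae] with vini hvini ξ₀ s₀
  let used : Vec n × Matrix (Fin n) (Fin n) ℝ → Vec n × Matrix (Fin n) (Fin n) ℝ →
    Vec n × Matrix (Fin n) (Fin n) ℝ := fun z z' => if d = 0 then z else z'
  have hstep : ∀ (k : ℕ) (a : Vec n × Vec n × Matrix (Fin n) (Fin n) ℝ),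
      (∀ p ∈ H, ⟪p.1, a.1⟫ ≠ p.2) →
      ∃ (e : ℝ) (a' : Vec n × Vec n × Matrix (Fin n) (Fin n) ℝ),
        (∀ p ∈ H, ⟪p.1, a'.1⟫ ≠ p.2) ∧ e ∈ Set.Icc (1 / ((k : ℝ) + 1)) (2 / ((k : ℝ) + 1)) ∧
        G.InnerReturns η a.1 a.2 (σ k) a'.2 ∧
        a'.1 = a.1 - e • G.hypergrad a.1 (used a.2 a'.2).1 (used a.2 a'.2).2 := by
    intro k a ha
    obtain ⟨z', hz'⟩ := hG.exists_innerReturns (hdiff a.1 ha) a.2 (hσ.1 k)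
    obtain ⟨e, he, hgood⟩ := exists_step_avoiding hH ha
      (g := G.hypergrad a.1 (used a.2 z').1 (used a.2 z').2)
      (show 1 / ((k : ℝ) + 1) < 2 / ((k : ℝ) + 1) by
        rw [div_lt_div_iff_of_pos_right (by positivity)]
        norm_num)
    exact ⟨e, (_, z'), hgood, he, hz', rfl⟩
  choose! e f hf1 hf2 hf3 hf4 using hstep
  let st : ℕ → Vec n × Vec n × Matrix (Fin n) (Fin n) ℝ := fun k =>
    Nat.rec (vini, ξ₀, s₀) (fun k a => f k a) k
  have hst : ∀ k, st (k + 1) = f k (st k) := fun k => rfl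
  have hgood : ∀ k, ∀ p ∈ H, ⟪p.1, (st k).1⟫ ≠ p.2 := by
    intro k
    induction k with
    | zero => exact hvini
    | succ k ih =>
      rw [hst]
      exact hf1 k _ ih
  refine ⟨fun k => e k (st k), fun k => (st k).1, fun k => (st k).2.1, fun k => (st k).2.2,
    isStepSeq_of_harmonic fun k => hf2 k _ (hgood k), rfl, rfl, rfl, fun k => ?_, fun k => ?_⟩
  · have := hf3 k _ (hgood k)
    rwa [← hst] at this
  · have := hf4 k _ (hgood k)
    rw [← hst] at this
    have hused : used (st k).2 (st (k + 1)).2 = (st (k + (d : ℕ))).2 := by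
      obtain rfl | rfl : d = 0 ∨ d = 1 := by omega
      · simp [used]
      · simp [used]
    rwa [hused] at this

end GridGame.IsContractive
theorem mainTheorem4 {n : ℕ} (G : GridGame n) (μ η : ℝ)
    (hX : G.X.IsSymm) (hC : ∀ i, 0 < G.C i) (hγ : 0 < G.γ) (hρ : 0 < G.ρ)
    (hbox : ∀ i, G.qlo i < G.qhi i)
    (hzero : ∀ i, G.qlo i ≤ 0 ∧ 0 ≤ G.qhi i)
    (hμ : 0 < μ) (hmin : ∀ t ∈ spectrum ℝ G.jacF, μ ≤ t)
    (hη : 0 < η) (hηL : η * specNorm G.jacF ^ 2 < 2 * μ) :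
    -- the lower-level game has exactly one Nash equilibrium, `G.nashEq vref`
    (∀ vref q : Vec n, G.IsNash vref q ↔ q = G.nashEq vref) ∧
    -- the equilibrium estimates converge linearly
    (Real.sqrt (1 - η * (2 * μ - η * specNorm G.jacF ^ 2)) < 1 ∧
      ∀ (vref ξ₀ : Vec n) (s₀ : Matrix (Fin n) (Fin n) ℝ) (l : ℕ),
        ‖(G.inner η vref (ξ₀, s₀) l).1 - G.nashEq vref‖ ≤
          Real.sqrt (1 - η * (2 * μ - η * specNorm G.jacF ^ 2)) ^ l * ‖ξ₀ - G.nashEq vref‖) ∧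
    -- the sensitivity estimates converge to the Jacobian of the equilibrium map
    (∀ (vref ξ₀ : Vec n) (s₀ : Matrix (Fin n) (Fin n) ℝ), DifferentiableAt ℝ G.nashEq vref →
      Tendsto (fun l => (G.inner η vref (ξ₀, s₀) l).2) atTop (𝓝 (jacobian G.nashEq vref))) ∧
    -- every infinite run converges to criticality, with convergence of the values
    (∀ (d : Fin 2) (ε σ : ℕ → ℝ) (vref ξ : ℕ → Vec n) (s : ℕ → Matrix (Fin n) (Fin n) ℝ),
      IsStepSeq ε → IsTolSeq σ → G.IsRun d η ε σ vref ξ s →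
        (∃ w : Vec n, MapClusterPt w atTop vref ∧
          Tendsto (fun k => G.phiE (vref k)) atTop (𝓝 (G.phiE w))) ∧
        ∀ w : Vec n, MapClusterPt w atTop vref → IsCritical G.phiE w) ∧
    -- infinite runs exist: all inner loops stop, for suitable step sizes
    (∀ (d : Fin 2) (σ : ℕ → ℝ), IsTolSeq σ →
      ∀ᵐ vini : Vec n, ∀ (ξ₀ : Vec n) (s₀ : Matrix (Fin n) (Fin n) ℝ),
        ∃ (ε : ℕ → ℝ) (vref ξ : ℕ → Vec n) (s : ℕ → Matrix (Fin n) (Fin n) ℝ),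
          IsStepSeq ε ∧ vref 0 = vini ∧ ξ 0 = ξ₀ ∧ s 0 = s₀ ∧ G.IsRun d η ε σ vref ξ s) := by
  have hG := G.isContractive_of_spectrum hX hγ hbox hμ hmin hη hηL
  exact ⟨hG.isNash_iff_eq, ⟨hG.lt_one, fun r ξ₀ s₀ l => hG.norm_inner_sub_nashEq_le r (ξ₀, s₀) l⟩,
    fun r ξ₀ s₀ hr => hG.tendsto_inner_snd hr (ξ₀, s₀),
    fun d ε σ vref ξ s hε hσ hrun => hG.run_converges hzero hε hσ hrun,
    fun d σ hσ => hG.ae_exists_run d hσ⟩
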